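/- Let $A\to M$ be a Lie algebroid of rank $n$ over a smooth manifold $M$, with anchor $a$, let $\mathcal A=\bigoplus_{0\le k\le n}\Gamma(\wedge^kA)$ with its Schouten (Gerstenhaber) bracket $[\cdot,\cdot]$, and let $d$ be the Lie algebroid differential on $\Gamma(\wedge^*A^*)$. Contraction of multivector fields with forms is normalized by $\langle\theta\lrcorner U,\eta\rangle=\langle U,\theta\wedge\eta\rangle$, and $i_\theta U=\theta\lrcorner U$. (1) Let $\tilde D$ and $D$ be $\mathbb R$-linear operators of degree $-1$ on $\mathcal A$ which generate the bracket, that is, $$[U,V]=(-1)^{|U|}\bigl(D(U\wedge V)-DU\wedge V-(-1)^{|U|}U\wedge DV\bigr),$$ and likewise for $\tilde D$. Then there is a section $\alpha\in\Gamma(A^*)$ with $D-\tilde D=i_\alpha$; for any such $\alpha$ one has $\tilde D^2-D^2=-i_{d\alpha}$; in particular, if $\tilde D^2=D^2=0$, then $d\alpha=0$. (2) For an $A$-connection $\nabla$ on the line bundle $\wedge^nA$, let $D_\nabla$ be the corresponding operator: if, near a point $m$, $U\in\Gamma(\wedge^kA)$ is written as $U=\omega\lrcorner\Lambda$ with $\omega\in\Gamma(\wedge^{n-k}A^*)$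 and $\Lambda\in\Gamma(\wedge^nA)$ nonvanishing at $m$, then $$D_\nabla U|_m=-(-1)^{n-k}\Bigl(d\omega\lrcorner\Lambda+\sum_{i=1}^n(\alpha_i\wedge\omega)\lrcorner\nabla_{X_i}\Lambda\Bigr)\Big|_m,$$ where $X_1,\dots,X_n$ is a basis of $A|_m$ and $\alpha_1,\dots,\alpha_n$ is its dual basis. If $\nabla$ is flat, let $H_*(A,\nabla)=\ker\partial/\operatorname{im}\partial$ with $\partial=(-1)^{n-k}D_\nabla:\Gamma(\wedge^kA)\to\Gamma(\wedge^{k-1}A)$. Let $\nabla_1,\nabla_2$ be flat $A$-connections on $\wedge^nA$. Then $\nabla_1$ and $\nabla_2$ are homotopic, i.e. $(\nabla_1)_Xs-(\nabla_2)_Xs=\langle df,X\rangle s$ for some $f\in C^\infty(M)$ (where $\langle df,X\rangle=a(X)f$), if and only if $D_{\nabla_1}$ and $D_{\nabla_2}$ are homotopic, i.e. $D_{\nabla_1}-D_{\nabla_2}=i_{dg}$ for some $g\in C^\infty(M)$; and in that case $H_k(A,\nabla_1)\cong H_k(A,\nabla_2)$, as real vector spaces, for every $k$. -/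

import Mathlib

open scoped Manifold ContDiff Topology

set_option linter.unusedSectionVars false

noncomputable section

namespace AlgebroidHomology

/-! ## Exterior algebra of a finite-dimensional vector space -/

section LinearAlgebra

variable {V : Type*} [AddCommGroup V] [Module ℝ V]

/-- The wedge product `v₁ ∧ ⋯ ∧ vₖ` of a list of vectors. -/
def wedge (l : List V) : ExteriorAlgebra ℝ V := (l.map (ExteriorAlgebra.ι ℝ)).prod

/-- The value on `(v₀, …, vₚ)` of the wedge product `ξ ∧ θ` of a covector `ξ` and a `p`-covector
`θ`. -/
def covectorWedge {p : ℕ} (ξ : Module.Dual ℝ V) (θ : (Fin p → V) → ℝ) (v : Fin (p + 1) → V) : ℝ :=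
  ∑ i : Fin (p + 1), (-1) ^ (i : ℕ) * ξ (v i) * θ (i.removeNth v)

/-- Contraction `θ ⌟ U` of a multivector `U` with a `p`-covector
`θ = (1 / p!) ∑ θ(b_{i₁}, …, b_{iₚ}) b^{i₁} ∧ ⋯ ∧ b^{iₚ}`, where `b` is a basis and `b^i` the dual
basis. The convention is `⟨θ ⌟ U, η⟩ = ⟨U, θ ∧ η⟩`, so that
`(ξ₁ ∧ ⋯ ∧ ξₚ) ⌟ U = ξₚ ⌟ (⋯ (ξ₁ ⌟ U))`, and for one covector `ξ` one has
`ξ ⌟ (v ∧ U) = ξ(v) U - v ∧ (ξ ⌟ U)` (this is `CliffordAlgebra.contractLeft`). -/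
def contract [FiniteDimensional ℝ V] {p : ℕ} (θ : (Fin p → V) → ℝ) (U : ExteriorAlgebra ℝ V) :
    ExteriorAlgebra ℝ V :=
  ((p.factorial : ℝ))⁻¹ • ∑ i : Fin p → Fin (Module.finrank ℝ V),
    θ (fun j => Module.finBasis ℝ V (i j)) •
      (List.ofFn i).foldl
        (fun W j => CliffordAlgebra.contractLeft ((Module.finBasis ℝ V).coord j) W) U

theorem contract_add [FiniteDimensional ℝ V] {p : ℕ} (θ θ' : (Fin p → V) → ℝ)
    (U : ExteriorAlgebra ℝ V) :
    contract (fun v => θ v + θ' v) U = contract θ U + contract θ' U := by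
  simp only [contract, add_smul, Finset.sum_add_distrib, smul_add]

theorem contract_smul [FiniteDimensional ℝ V] {p : ℕ} (c : ℝ) (θ : (Fin p → V) → ℝ)
    (U : ExteriorAlgebra ℝ V) :
    contract (fun v => c * θ v) U = c • contract θ U := by
  simp only [contract, mul_smul, ← Finset.smul_sum]
  rw [smul_comm]

end LinearAlgebra

/-! ## Sections, multivector fields and forms of a smooth vector bundle

Throughout, `M` is a smooth manifold modelled on the finite-dimensional space `E`, and `A` is a
smooth real vector bundle over `M` with finite-dimensional model fibre `F`. -/

section Bundle

variable (E : Type*) [NormedAddCommGroup E] [NormedSpace ℝ E] 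
  {M : Type*} [TopologicalSpace M] [ChartedSpace E M] 
  (F : Type*) [NormedAddCommGroup F] [NormedSpace ℝ F]
  (A : M → Type*) [TopologicalSpace (Bundle.TotalSpace F A)] [∀ x, TopologicalSpace (A x)]
  [∀ x, AddCommGroup (A x)] [∀ x, Module ℝ (A x)]
  [FiberBundle F A] [VectorBundle ℝ F A]

/-- The space `Γ(A)` of smooth sections. -/
abbrev Sec := Cₛ^∞⟮𝓘(ℝ, E); F, A⟯

variable (M) in
/-- The algebra `C^∞(M)` of smooth real functions. -/
abbrev Fn := C^∞⟮𝓘(ℝ, E), M; ℝ⟯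

variable {E F A}

/-- The product `f X` of a smooth function and a smooth section. -/
def fnSmul (f : Fn E M) (X : Sec E F A) : Sec E F A :=
  ⟨fun x => f x • X x, f.contMDiff.smul_section X.contMDiff⟩

/-- The multivector field `∑ f X₁ ∧ ⋯ ∧ Xₖ`, the sum being over a finite list of pairs of a
smooth function `f` and a list `X₁, …, Xₖ` of smooth sections. -/
def evalTerms (S : List (Fn E M × List (Sec E F A))) (x : M) : ExteriorAlgebra ℝ (A x) :=
  (S.map fun t => t.1 x • wedge (t.2.map fun X => X x)).sum

/-- Smoothness of a section of the bundle `∧ A` of exterior algebras: near each point it is a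
finite sum of wedge products of smooth sections of `A`, with smooth coefficients. -/
def IsSmoothMultivector (U : (x : M) → ExteriorAlgebra ℝ (A x)) : Prop :=
  ∀ x : M, ∃ S : List (Fn E M × List (Sec E F A)), ∀ᶠ y in 𝓝 x, U y = evalTerms S y

theorem evalTerms_append (S T : List (Fn E M × List (Sec E F A))) (x : M) :
    evalTerms (S ++ T) x = evalTerms S x + evalTerms T x := by
  simp [evalTerms]

theorem evalTerms_mul (S T : List (Fn E M × List (Sec E F A))) (x : M) :
    evalTerms (S.flatMap fun s => T.map fun t => (s.1 * t.1, s.2 ++ t.2)) x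
      = evalTerms S x * evalTerms T x := by
  induction S with
  | nil => simp [evalTerms]
  | cons s S ih =>
    rw [List.flatMap_cons, evalTerms_append, ih]
    have h1 : evalTerms (s :: S) x = s.1 x • wedge (s.2.map fun X => X x) + evalTerms S x := by
      simp [evalTerms]
    rw [h1, add_mul]
    congr 1
    clear ih h1
    induction T with
    | nil => simp [evalTerms]
    | cons t T ihT =>
      have h2 : evalTerms (t :: T) x = t.1 x • wedge (t.2.map fun X => X x) + evalTerms T x := by
        simp [evalTerms]
      rw [h2, mul_add, ← ihT]
      simp [evalTerms, wedge, mul_smul, smul_comm (t.1 x) (s.1 x)]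

variable (E F A) in
/-- The smooth sections of `∧ A`, as a subalgebra of the algebra of all sections. -/
def smoothMultivectors : Subalgebra ℝ ((x : M) → ExteriorAlgebra ℝ (A x)) where
  carrier := {U | IsSmoothMultivector (E := E) (F := F) U}
  mul_mem' := by
    intro U V hU hV x
    obtain ⟨S, hS⟩ := hU x
    obtain ⟨T, hT⟩ := hV x
    refine ⟨S.flatMap fun s => T.map fun t => (s.1 * t.1, s.2 ++ t.2), ?_⟩
    filter_upwards [hS, hT] with y h1 h2
    rw [evalTerms_mul, Pi.mul_apply, h1, h2]
  add_mem' := by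
    intro U V hU hV x
    obtain ⟨S, hS⟩ := hU x
    obtain ⟨T, hT⟩ := hV x
    refine ⟨S ++ T, ?_⟩
    filter_upwards [hS, hT] with y h1 h2
    rw [evalTerms_append, Pi.add_apply, h1, h2]
  algebraMap_mem' := by
    intro r x
    refine ⟨[(ContMDiffMap.const r, [])], Filter.Eventually.of_forall fun y => ?_⟩
    simp [evalTerms, wedge, ContMDiffMap.const, Algebra.algebraMap_eq_smul_one]

variable (E F A) in
/-- The algebra `𝒜 = ⨁ₖ Γ(∧ᵏ A)` of smooth sections of `∧ A`, with the pointwise wedge product. -/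
def MultiField : Type _ := smoothMultivectors E F A

instance : Ring (MultiField E F A) := inferInstanceAs (Ring (smoothMultivectors E F A))

instance : Algebra ℝ (MultiField E F A) :=
  inferInstanceAs (Algebra ℝ (smoothMultivectors E F A))

variable (E F A) in
/-- The homogeneous part `𝒜ᵏ = Γ(∧ᵏ A)`. -/
def MultiField.grade (k : ℕ) : Submodule ℝ (MultiField E F A) where
  carrier := {U | ∀ x, U.1 x ∈ ⋀[ℝ]^k (A x)}
  add_mem' := fun hU hV x => Submodule.add_mem _ (hU x) (hV x)
  zero_mem' := fun _ => Submodule.zero_mem _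
  smul_mem' := fun c _ hU x => Submodule.smul_mem _ c (hU x)

/-- The product `f U` of a smooth function and a multivector field of degree `k`. -/
def gradeSmul {k : ℕ} (f : Fn E M) (U : MultiField.grade E F A k) : MultiField.grade E F A k :=
  ⟨⟨fun x => f x • U.1.1 x, by
    intro x
    obtain ⟨S, hS⟩ := U.1.2 x
    refine ⟨S.map fun t => (f * t.1, t.2), ?_⟩
    filter_upwards [hS] with y hy
    rw [hy]
    simp [evalTerms, Function.comp_def, mul_smul, List.smul_sum]⟩,
  fun x => Submodule.smul_mem _ _ (U.2 x)⟩

variable (E F A) in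
/-- Smooth sections of `∧ᵖ A*`: families of alternating `p`-forms on the fibres of `A` that give a
smooth function on all tuples of smooth sections. -/
structure Form (p : ℕ) where
  toFun : (x : M) → (A x) [⋀^Fin p]→ₗ[ℝ] ℝ
  smooth : ∀ X : Fin p → Sec E F A,
    ContMDiff 𝓘(ℝ, E) 𝓘(ℝ, ℝ) ∞ fun x => toFun x fun i => X i x

/-- The contraction `contract` in the fibre of `A` over `x`. -/
def contractAt (F : Type*) [NormedAddCommGroup F] [NormedSpace ℝ F] [FiniteDimensional ℝ F]
    {A : M → Type*} [TopologicalSpace (Bundle.TotalSpace F A)] [∀ x, TopologicalSpace (A x)]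
    [∀ x, AddCommGroup (A x)] [∀ x, Module ℝ (A x)] [FiberBundle F A] [VectorBundle ℝ F A]
    {p : ℕ} (x : M) (θ : (Fin p → A x) → ℝ) (U : ExteriorAlgebra ℝ (A x)) :
    ExteriorAlgebra ℝ (A x) :=
  haveI : FiniteDimensional ℝ (A x) := VectorBundle.finiteDimensional ℝ F A x
  contract θ U

/-- Every vector is the value of a smooth section. -/
theorem exists_section [FiniteDimensional ℝ E] [T2Space M] [IsManifold 𝓘(ℝ, E) ∞ M]
    [ContMDiffVectorBundle ∞ F A 𝓘(ℝ, E)] (x : M) (v : A x) : ∃ X : Sec E F A, X x = v := by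
  obtain ⟨s, hs, hsv⟩ := FiberBundle.exists_contMDiffOn_extend (k := ∞) 𝓘(ℝ, E) F v
  obtain ⟨u, hus, hu, hxu⟩ := mem_nhds_iff.1 hs
  obtain ⟨ψ, -, hψ⟩ := (SmoothBumpFunction.nhds_basis_tsupport (I := 𝓘(ℝ, E)) x).mem_iff.1
    (hu.mem_nhds hxu)
  refine ⟨⟨(fun y => ψ y) • FiberBundle.extend F v, ?_⟩, ?_⟩
  · exact (ψ.contMDiff.contMDiffOn).smul_section_of_tsupport hu hψ (hsv.mono hus)
  · simp

variable (E F) in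
/-- A smooth section through a given vector. -/
def sectionThrough [FiniteDimensional ℝ E] [T2Space M] [IsManifold 𝓘(ℝ, E) ∞ M]
    [ContMDiffVectorBundle ∞ F A 𝓘(ℝ, E)] {x : M} (v : A x) : Sec E F A :=
  (exists_section x v).choose

/-- The derivative of a real function `f` along a tangent vector `v` at `x`. -/
def dirDeriv (f : M → ℝ) (x : M) (v : TangentSpace 𝓘(ℝ, E) x) : ℝ :=
  mfderiv 𝓘(ℝ, E) 𝓘(ℝ, ℝ) f x v

theorem dirDeriv_add {f g : M → ℝ} (hf : ContMDiff 𝓘(ℝ, E) 𝓘(ℝ, ℝ) ∞ f)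
    (hg : ContMDiff 𝓘(ℝ, E) 𝓘(ℝ, ℝ) ∞ g) (x : M) (v : TangentSpace 𝓘(ℝ, E) x) :
    dirDeriv (fun y => f y + g y) x v = dirDeriv f x v + dirDeriv g x v := by
  have h := mfderiv_add ((hf x).mdifferentiableAt (by simp)) ((hg x).mdifferentiableAt (by simp))
  exact congrArg (fun T => T v) h

theorem dirDeriv_smul {f : M → ℝ} (c : ℝ) (hf : ContMDiff 𝓘(ℝ, E) 𝓘(ℝ, ℝ) ∞ f)
    (x : M) (v : TangentSpace 𝓘(ℝ, E) x) :
    dirDeriv (fun y => c * f y) x v = c * dirDeriv f x v := by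
  have h := const_smul_mfderiv ((hf x).mdifferentiableAt (by simp)) c
  exact congrArg (fun T => T v) h

/-- The sum of two forms. -/
def Form.add {p : ℕ} (θ θ' : Form E F A p) : Form E F A p :=
  ⟨fun x => θ.toFun x + θ'.toFun x, fun X => (θ.smooth X).add (θ'.smooth X)⟩

/-- The product of a form and a real number. -/
def Form.smul {p : ℕ} (c : ℝ) (θ : Form E F A p) : Form E F A p :=
  ⟨fun x => c • θ.toFun x, fun X => contMDiff_const.mul (θ.smooth X)⟩

end Bundle

/-! ## Lie algebroids, the Schouten bracket, generating operators, connections, homology -/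

section Algebroid

variable (E : Type*) [NormedAddCommGroup E] [NormedSpace ℝ E] [FiniteDimensional ℝ E]
  {M : Type*} [TopologicalSpace M] [T2Space M] [ChartedSpace E M] [IsManifold 𝓘(ℝ, E) ∞ M]
  (F : Type*) [NormedAddCommGroup F] [NormedSpace ℝ F] [FiniteDimensional ℝ F]
  (A : M → Type*) [TopologicalSpace (Bundle.TotalSpace F A)] [∀ x, TopologicalSpace (A x)]
  [∀ x, AddCommGroup (A x)] [∀ x, Module ℝ (A x)]
  [FiberBundle F A] [VectorBundle ℝ F A] [ContMDiffVectorBundle ∞ F A 𝓘(ℝ, E)]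

/-- A Lie algebroid structure on the vector bundle `A → M`: a Lie bracket on `Γ(A)` and a smooth
bundle map `A → TM`, the anchor, which is compatible with the brackets, and satisfies the Leibniz
rule. -/
structure LieAlgebroid where
  bracket : Sec E F A →ₗ[ℝ] Sec E F A →ₗ[ℝ] Sec E F A
  bracket_self : ∀ X, bracket X X = 0
  jacobi : ∀ X Y Z, bracket X (bracket Y Z) = bracket (bracket X Y) Z + bracket Y (bracket X Z)
  anchor : (x : M) → A x →ₗ[ℝ] TangentSpace 𝓘(ℝ, E) x
  anchor_smooth : ∀ X : Sec E F A, ContMDiff 𝓘(ℝ, E) 𝓘(ℝ, E).tangent ∞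
    fun x => (⟨x, anchor x (X x)⟩ : TangentBundle 𝓘(ℝ, E) M)
  anchor_bracket : ∀ (X Y : Sec E F A) (x : M), anchor x (bracket X Y x) =
    VectorField.mlieBracket 𝓘(ℝ, E) (fun y => anchor y (X y)) (fun y => anchor y (Y y)) x
  leibniz : ∀ (X Y : Sec E F A) (f : Fn E M) (x : M), bracket X (fnSmul f Y) x =
    f x • bracket X Y x + dirDeriv f x (anchor x (X x)) • Y x

variable {E F A}

namespace LieAlgebroid

variable (L : LieAlgebroid E F A)

/-- The function `a(X) f`. -/
def act (X : Sec E F A) (f : M → ℝ) (x : M) : ℝ := dirDeriv f x (L.anchor x (X x))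

/-! ### The differential of Lie algebroid forms -/

/-- The part `∑_{i < j} (-1)^{i+j} θ([Xᵢ, Xⱼ], X₀, …, X̂ᵢ, …, X̂ⱼ, …, Xₚ)` of the differential. -/
def dBracketPart : {p : ℕ} → Form E F A p → (Fin (p + 1) → Sec E F A) → M → ℝ
  | 0, _, _, _ => 0
  | q + 1, θ, X, x => ∑ j : Fin (q + 2), ∑ i : Fin (q + 1),
      if i.castSucc < j then
        (-1) ^ ((i : ℕ) + (j : ℕ)) * θ.toFun x (Fin.cons (L.bracket (X i.castSucc) (X j) x)
          fun l => i.removeNth (j.removeNth X) l x)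
      else 0

/-- The value `(dθ)(X₀, …, Xₚ) = ∑ᵢ (-1)^i a(Xᵢ) θ(X₀, …, X̂ᵢ, …, Xₚ) +
∑_{i < j} (-1)^{i+j} θ([Xᵢ, Xⱼ], X₀, …, X̂ᵢ, …, X̂ⱼ, …, Xₚ)` of the differential on sections. -/
def dOnSections {p : ℕ} (θ : Form E F A p) (X : Fin (p + 1) → Sec E F A) (x : M) : ℝ :=
  ∑ i : Fin (p + 1), (-1) ^ (i : ℕ) *
      L.act (X i) (fun y => θ.toFun y fun l => i.removeNth X l y) x
    + L.dBracketPart θ X x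

/-- The differential `dθ` at `x`, as a function of vectors `v₀, …, vₚ` in the fibre: its value on
any smooth sections through these vectors (the choice of the sections does not matter). -/
def d {p : ℕ} (θ : Form E F A p) (x : M) (v : Fin (p + 1) → A x) : ℝ :=
  L.dOnSections θ (fun i => sectionThrough E F (v i)) x

theorem d_zero {p : ℕ} (x : M) (v : Fin (p + 1) → A x) :
    L.d (⟨fun _ => 0, fun _ => contMDiff_const⟩ : Form E F A p) x v = 0 := by
  have h0 : ∀ (w : TangentSpace 𝓘(ℝ, E) x), dirDeriv (fun _ : M => (0 : ℝ)) x w = 0 := by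
    intro w
    have h : mfderiv 𝓘(ℝ, E) 𝓘(ℝ, ℝ) (fun _ : M => (0 : ℝ)) x = 0 := mfderiv_const
    exact congrArg (fun T => T w) h
  cases p <;> simp [d, dOnSections, dBracketPart, act, h0]

theorem d_add {p : ℕ} (θ θ' : Form E F A p) (x : M) (v : Fin (p + 1) → A x) :
    L.d (θ.add θ') x v = L.d θ x v + L.d θ' x v := by
  have hb : ∀ X, L.dBracketPart (θ.add θ') X x
      = L.dBracketPart θ X x + L.dBracketPart θ' X x := by
    intro X
    cases p with
    | zero => simp [dBracketPart]
    | succ q =>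
      simp only [dBracketPart, ← Finset.sum_add_distrib]
      refine Finset.sum_congr rfl fun j _ => Finset.sum_congr rfl fun i _ => ?_
      split_ifs
      · exact mul_add _ _ _
      · simp
  simp only [d, dOnSections, hb]
  rw [add_add_add_comm, ← Finset.sum_add_distrib]
  congr 1
  refine Finset.sum_congr rfl fun i _ => ?_
  rw [← mul_add]
  congr 1
  exact dirDeriv_add (θ.smooth _) (θ'.smooth _) x _

theorem d_smul {p : ℕ} (c : ℝ) (θ : Form E F A p) (x : M) (v : Fin (p + 1) → A x) :
    L.d (θ.smul c) x v = c * L.d θ x v := by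
  have hb : ∀ X, L.dBracketPart (θ.smul c) X x = c * L.dBracketPart θ X x := by
    intro X
    cases p with
    | zero => simp [dBracketPart]
    | succ q =>
      simp only [dBracketPart, Finset.mul_sum]
      refine Finset.sum_congr rfl fun j _ => Finset.sum_congr rfl fun i _ => ?_
      split_ifs
      · exact mul_left_comm _ _ _
      · simp
  simp only [d, dOnSections, hb]
  rw [mul_add, Finset.mul_sum]
  congr 1
  refine Finset.sum_congr rfl fun i _ => ?_
  rw [mul_left_comm]
  congr 1
  exact dirDeriv_smul c (θ.smooth _) x _

/-- A `1`-form is closed if its differential vanishes. -/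
def IsClosedForm (α : Form E F A 1) : Prop := ∀ x v, L.d α x v = 0

/-- A `1`-form is exact if it is the differential `df` of a smooth function, `⟨df, X⟩ = a(X) f`. -/
def IsExactForm (α : Form E F A 1) : Prop :=
  ∃ f : Fn E M, ∀ (x : M) (v : Fin 1 → A x), α.toFun x v = dirDeriv f x (L.anchor x (v 0))

/-! ### The Schouten bracket and generating operators -/

/-- The Schouten bracket `[f X₁ ∧ ⋯ ∧ Xᵤ, g Y₁ ∧ ⋯ ∧ Yᵥ]` at `x`, namely
`f g ∑ (-1)^{i+j} [Xᵢ, Yⱼ] ∧ X₁ ∧ ⋯ X̂ᵢ ⋯ ∧ Xᵤ ∧ Y₁ ∧ ⋯ Ŷⱼ ⋯ ∧ Yᵥ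
+ (-1)^{u-1} f ∑ (-1)^{i-1} (a(Xᵢ) g) X₁ ∧ ⋯ X̂ᵢ ⋯ ∧ Xᵤ ∧ Y₁ ∧ ⋯ ∧ Yᵥ
- g ∑ (-1)^{j-1} (a(Yⱼ) f) X₁ ∧ ⋯ ∧ Xᵤ ∧ Y₁ ∧ ⋯ Ŷⱼ ⋯ ∧ Yᵥ`. -/
def schoutenTerm (s t : Fn E M × List (Sec E F A)) (x : M) : ExteriorAlgebra ℝ (A x) :=
  (s.1 x * t.1 x) • ∑ i : Fin s.2.length, ∑ j : Fin t.2.length,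
      (-1 : ℝ) ^ ((i : ℕ) + (j : ℕ)) •
        (ExteriorAlgebra.ι ℝ (L.bracket (s.2.get i) (t.2.get j) x) *
          wedge ((s.2.eraseIdx i).map fun X => X x) * wedge ((t.2.eraseIdx j).map fun Y => Y x))
    + ((-1) ^ (s.2.length + 1) * s.1 x) • ∑ i : Fin s.2.length,
      ((-1) ^ (i : ℕ) * L.act (s.2.get i) t.1 x) •
        (wedge ((s.2.eraseIdx i).map fun X => X x) * wedge (t.2.map fun Y => Y x))
    - t.1 x • ∑ j : Fin t.2.length,
      ((-1) ^ (j : ℕ) * L.act (t.2.get j) s.1 x) •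
        (wedge (s.2.map fun X => X x) * wedge ((t.2.eraseIdx j).map fun Y => Y x))

/-- `W` is the Schouten bracket `[U, V]`, the bracket of the Gerstenhaber algebra `𝒜` of the Lie
algebroid: it is obtained by expanding `U` and `V`, near each point, into sums of decomposable
multivector fields, and applying `schoutenTerm` bilinearly (the choice of the expansions does not
matter). -/
def IsSchoutenBracket (U V W : MultiField E F A) : Prop :=
  ∀ (x : M) (S T : List (Fn E M × List (Sec E F A))),
    (∀ᶠ y in 𝓝 x, U.1 y = evalTerms S y) → (∀ᶠ y in 𝓝 x, V.1 y = evalTerms T y) →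
      W.1 x = (S.map fun s => (T.map fun t => L.schoutenTerm s t x).sum).sum

/-- `D` is a linear operator on `𝒜` of degree `-1` that generates the Gerstenhaber bracket:
`[U, V] = (-1)^{|U|} (D(U ∧ V) - DU ∧ V - (-1)^{|U|} U ∧ DV)`. -/
structure IsGenerating (D : MultiField E F A →ₗ[ℝ] MultiField E F A) : Prop where
  degree : ∀ k, ∀ U ∈ MultiField.grade E F A (k + 1), D U ∈ MultiField.grade E F A k
  degree_zero : ∀ U ∈ MultiField.grade E F A 0, D U = 0
  generates : ∀ u, ∀ U ∈ MultiField.grade E F A u, ∀ V : MultiField E F A,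
    L.IsSchoutenBracket U V
      ((-1 : ℝ) ^ u • (D (U * V) - D U * V - (-1 : ℝ) ^ u • (U * D V)))

/-- Two operators on `𝒜` are homotopic if they differ by contraction with an exact `1`-form. -/
def HomotopicOperators (D₁ D₂ : MultiField E F A →ₗ[ℝ] MultiField E F A) : Prop :=
  ∃ α : Form E F A 1, L.IsExactForm α ∧
    ∀ (U : MultiField E F A) (x : M),
      (D₁ U).1 x - (D₂ U).1 x = contractAt F x (α.toFun x) (U.1 x)

/-! ### Connections on the canonical line bundle -/

/-- An `A`-connection on the line bundle `∧ⁿ A`, where `n` is the rank of `A`. -/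
structure TopConnection where
  nabla : Sec E F A →ₗ[ℝ] MultiField.grade E F A (Module.finrank ℝ F) →ₗ[ℝ]
    MultiField.grade E F A (Module.finrank ℝ F)
  smul_left : ∀ (f : Fn E M) X s, nabla (fnSmul f X) s = gradeSmul f (nabla X s)
  leibniz : ∀ (f : Fn E M) X s (x : M), (nabla X (gradeSmul f s)).1.1 x =
    L.act X f x • s.1.1 x + f x • (nabla X s).1.1 x

variable {L}

namespace TopConnection

/-- The curvature vanishes. -/
def IsFlat (C : L.TopConnection) : Prop :=
  ∀ X Y s, C.nabla X (C.nabla Y s) - C.nabla Y (C.nabla X s) - C.nabla (L.bracket X Y) s = 0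

/-- Two connections are homotopic if they differ by an exact `1`-form `α`, that is,
`∇¹_X s = ∇²_X s + ⟨α, X⟩ s`. -/
def Homotopic (C₁ C₂ : L.TopConnection) : Prop :=
  ∃ α : Form E F A 1, L.IsExactForm α ∧ ∀ X s (x : M),
    (C₁.nabla X s).1.1 x = (C₂.nabla X s).1.1 x + α.toFun x (fun _ => X x) • s.1.1 x

/-- The relation `W = D U`, for a multivector field `U` of degree `k`, where `D` is the operator on
`𝒜` that corresponds to the connection `∇`: near each point `x` write `U = θ ⌟ Λ` with an
`(n - k)`-form `θ` and a section `Λ` of `∧ⁿ A` that does not vanish at `x`; then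
`(D U)(x) = -(-1)^{n-k} (dθ ⌟ Λ + ∑ᵢ (αᵢ ∧ θ) ⌟ ∇_{Xᵢ} Λ)(x)`, where the `Xᵢ` form a basis of the
fibre over `x` and `αᵢ` is the dual basis. (The form `θ` is unique near `x`, and the result
does not depend on the choice of `Λ` and of the basis.) -/
def IsD (C : L.TopConnection) (k : ℕ) (U W : MultiField E F A) : Prop :=
  ∀ (x : M) (Λ : MultiField.grade E F A (Module.finrank ℝ F)), Λ.1.1 x ≠ 0 →
    ∀ (X : Fin (Module.finrank ℝ F) → Sec E F A)
      (b : Module.Basis (Fin (Module.finrank ℝ F)) ℝ (A x)), (∀ i, b i = X i x) →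
    ∃ θ : Form E F A (Module.finrank ℝ F - k),
      (∀ᶠ y in 𝓝 x, U.1 y = contractAt F y (θ.toFun y) (Λ.1.1 y)) ∧
      W.1 x = -(-1 : ℝ) ^ (Module.finrank ℝ F - k) •
        (contractAt F x (L.d θ x) (Λ.1.1 x) +
          ∑ i, contractAt F x (covectorWedge (b.coord i) (θ.toFun x)) ((C.nabla (X i) Λ).1.1 x))

/-- `D` is the operator on `𝒜` that corresponds to the connection. -/
def IsOperator (C : L.TopConnection) (D : MultiField E F A →ₗ[ℝ] MultiField E F A) : Prop :=
  ∀ k, ∀ U ∈ MultiField.grade E F A k, C.IsD k U (D U)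

/-! ### Homology

The boundary operator is `∂ = (-1)^{n-k} D : 𝒜ᵏ → 𝒜ᵏ⁻¹`. -/

theorem IsD.zero (C : L.TopConnection) (k : ℕ) : C.IsD k 0 0 := by
  intro x Λ _ X b _
  have hz : ∀ {p : ℕ} (y : M) (U : ExteriorAlgebra ℝ (A y)),
      contractAt F y (fun _ : Fin p → A y => (0 : ℝ)) U = 0 := by
    intro p y U
    simp [contractAt, contract]
  refine ⟨⟨fun _ => 0, fun _ => contMDiff_const⟩, Filter.Eventually.of_forall fun y => ?_, ?_⟩
  · exact (hz y _).symm
  · have h1 : L.d (⟨fun _ => 0, fun _ => contMDiff_const⟩ : Form E F A (Module.finrank ℝ F - k)) x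
        = fun _ => 0 := by
      funext v
      exact L.d_zero x v
    have h2 : ∀ i, covectorWedge (b.coord i)
        (0 : (A x) [⋀^Fin (Module.finrank ℝ F - k)]→ₗ[ℝ] ℝ) = fun _ => 0 := by
      intro i; funext v; simp [covectorWedge]
    simp only [h1, h2, hz]
    simp only [Finset.sum_const_zero, add_zero, smul_zero]
    rfl

theorem IsD.add {C : L.TopConnection} {k : ℕ} {U U' W W' : MultiField E F A}
    (h : C.IsD k U W) (h' : C.IsD k U' W') : C.IsD k (U + U') (W + W') := by
  intro x Λ hΛ X b hb
  obtain ⟨θ, hθ, hW⟩ := h x Λ hΛ X b hb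
  obtain ⟨θ', hθ', hW'⟩ := h' x Λ hΛ X b hb
  have hc : ∀ {p : ℕ} (y : M) (τ τ' : (Fin p → A y) → ℝ) (V : ExteriorAlgebra ℝ (A y)),
      contractAt F y (fun v => τ v + τ' v) V = contractAt F y τ V + contractAt F y τ' V := by
    intro p y τ τ' V
    exact @contract_add (A y) _ _ (VectorBundle.finiteDimensional ℝ F A y) p τ τ' V
  refine ⟨θ.add θ', ?_, ?_⟩
  · filter_upwards [hθ, hθ'] with y h1 h2
    exact (congrArg₂ (· + ·) h1 h2).trans (hc y _ _ _).symm
  · have h1 : L.d (θ.add θ') x = fun v => L.d θ x v + L.d θ' x v := by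
      funext v; exact L.d_add θ θ' x v
    have h2 : ∀ i, covectorWedge (b.coord i) ((θ.add θ').toFun x) = fun v =>
        covectorWedge (b.coord i) (θ.toFun x) v + covectorWedge (b.coord i) (θ'.toFun x) v := by
      intro i; funext v
      simp [covectorWedge, Form.add, mul_add, Finset.sum_add_distrib]
    have h3 : (W + W').1 x = W.1 x + W'.1 x := rfl
    rw [h3, hW, hW', h1, hc]
    simp only [h2, hc, Finset.sum_add_distrib]
    rw [← smul_add]
    congr 1
    abel

theorem IsD.smul {C : L.TopConnection} {k : ℕ} {U W : MultiField E F A} (c : ℝ)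
    (h : C.IsD k U W) : C.IsD k (c • U) (c • W) := by
  intro x Λ hΛ X b hb
  obtain ⟨θ, hθ, hW⟩ := h x Λ hΛ X b hb
  have hc : ∀ {p : ℕ} (y : M) (τ : (Fin p → A y) → ℝ) (V : ExteriorAlgebra ℝ (A y)),
      contractAt F y (fun v => c * τ v) V = c • contractAt F y τ V := by
    intro p y τ V
    exact @contract_smul (A y) _ _ (VectorBundle.finiteDimensional ℝ F A y) p c τ V
  refine ⟨θ.smul c, ?_, ?_⟩
  · filter_upwards [hθ] with y h1
    exact (congrArg (c • ·) h1).trans (hc y _ _).symm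
  · have h1 : L.d (θ.smul c) x = fun v => c * L.d θ x v := by
      funext v; exact L.d_smul c θ x v
    have h2 : ∀ i, covectorWedge (b.coord i) ((θ.smul c).toFun x) = fun v =>
        c * covectorWedge (b.coord i) (θ.toFun x) v := by
      intro i; funext v
      simp only [covectorWedge, Form.smul, AlternatingMap.smul_apply, smul_eq_mul, Finset.mul_sum]
      exact Finset.sum_congr rfl fun j _ => by ring
    have h3 : (c • W).1 x = c • W.1 x := rfl
    rw [h3, hW, h1, hc]
    simp only [h2, hc, ← Finset.smul_sum, ← smul_add]
    rw [smul_comm]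

/-- The relation `W = ∂ U` for `U` of degree `k`, with `∂ = (-1)^{n-k} D`. -/
def IsBoundary (C : L.TopConnection) (k : ℕ) (U W : MultiField E F A) : Prop :=
  C.IsD k U ((-1 : ℝ) ^ (Module.finrank ℝ F - k) • W)

/-- The kernel of `∂` on `𝒜ᵏ`. -/
def cycles (C : L.TopConnection) (k : ℕ) : Submodule ℝ (MultiField E F A) where
  carrier := {U | U ∈ MultiField.grade E F A k ∧ C.IsBoundary k U 0}
  zero_mem' := ⟨Submodule.zero_mem _, by
    simpa only [IsBoundary, smul_zero] using IsD.zero C k⟩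
  add_mem' := fun hU hV => ⟨Submodule.add_mem _ hU.1 hV.1, by
    simpa only [IsBoundary, smul_zero, add_zero] using IsD.add hU.2 hV.2⟩
  smul_mem' := fun c _ hU => ⟨Submodule.smul_mem _ c hU.1, by
    simpa only [IsBoundary, smul_zero] using IsD.smul c hU.2⟩

/-- The image of `∂ : 𝒜ᵏ⁺¹ → 𝒜ᵏ`. -/
def boundaries (C : L.TopConnection) (k : ℕ) : Submodule ℝ (MultiField E F A) where
  carrier := {W | W ∈ MultiField.grade E F A k ∧
    ∃ V ∈ MultiField.grade E F A (k + 1), C.IsBoundary (k + 1) V W}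
  zero_mem' := ⟨Submodule.zero_mem _, 0, Submodule.zero_mem _, by
    simpa only [IsBoundary, smul_zero] using IsD.zero C (k + 1)⟩
  add_mem' := fun hU hV => by
    obtain ⟨hU, V, hV1, hV2⟩ := hU
    obtain ⟨hU', V', hV1', hV2'⟩ := hV
    refine ⟨Submodule.add_mem _ hU hU', V + V', Submodule.add_mem _ hV1 hV1', ?_⟩
    simpa only [IsBoundary, smul_add] using IsD.add hV2 hV2'
  smul_mem' := fun c W hW => by
    obtain ⟨hW, V, hV1, hV2⟩ := hW
    refine ⟨Submodule.smul_mem _ c hW, c • V, Submodule.smul_mem _ c hV1, ?_⟩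
    have := IsD.smul c hV2
    rw [smul_comm] at this
    exact this

/-- The Lie algebroid homology `H_k(A, ∇) = ker ∂ / im ∂` in degree `k`. -/
abbrev Homology (C : L.TopConnection) (k : ℕ) : Type _ :=
  C.cycles k ⧸ (C.boundaries k).submoduleOf (C.cycles k)

end TopConnection

end LieAlgebroid

end Algebroid

end AlgebroidHomology

end

/-! Generating operators. The bracket measures how far a generating operator is from being a
derivation, so two of them fail in the same way, and δ = D - D̃ satisfies δ(U ∧ V) = δU ∧ V +
(-1)^{|U|} U ∧ δV (`IsGenerating.sub_map_mul`). Having degree -1, δ kills functions; hence it is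
linear over functions and determined by the functions δX. These define a section α of A*, and δ =
i_α (`IsGenerating.exists_form_sub_eq_contract`). Since i_α² = 0, squaring D̃ = D - i_α gives D̃² -
D² = -(D i_α + i_α D), and everything rests on the Cartan-type identity D i_α + i_α D = i_{dα}
(`IsGenerating.anticommutator_contraction`). Both sides are linear over functions, so X₁ ∧ ⋯ ∧ Xₖ
suffices. The induction on k uses the Lie derivative L_Y = [Y, ·] expressed through D, and the
commutator L_Y i_α - i_α L_Y = i_{i_Y dα} + i_{d⟨α, Y⟩}. Closedness follows because contracting v ∧
w with dα gives the number dα(v, w).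

Connections. Near a point where Λ is nonzero, the form θ with U = θ ⌟ Λ is unique
(`contractAt_injective`). Two connections therefore use the same θ, the terms dθ ⌟ Λ cancel, and if
∇₁ - ∇₂ = β then D_{∇₁} - D_{∇₂} = -i_β (`IsOperator.sub_eq_contract`). Thus one difference is exact
if and only if the other is, with g = -f. To recover β from the operators, they are tested on
multivector fields of degree 1.

Homology. If β = df, multiplication by exp f intertwines the operators: d(e^f θ) = e^f (dθ + df ∧
θ), and the extra df ∧ θ is the change in the connection term (`IsD.expMul`). The inverse is
multiplication by exp(-f), so cycles and boundaries correspond. -/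

noncomputable section

namespace AlgebroidHomology

/-! ### Wedge products and iterated contractions with covectors -/

section LinearAlgebra

variable {V : Type*} [AddCommGroup V] [Module ℝ V]

/-- Contraction of a multivector with one covector. -/
abbrev covectorContract (ξ : Module.Dual ℝ V) : ExteriorAlgebra ℝ V →ₗ[ℝ] ExteriorAlgebra ℝ V :=
  CliffordAlgebra.contractLeft (Q := (0 : QuadraticForm ℝ V)) ξ

theorem covectorContract_ι_mul (ξ : Module.Dual ℝ V) (v : V) (U : ExteriorAlgebra ℝ V) :
    covectorContract ξ (ExteriorAlgebra.ι ℝ v * U) =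
      ξ v • U - ExteriorAlgebra.ι ℝ v * covectorContract ξ U :=
  CliffordAlgebra.contractLeft_ι_mul ..

theorem covectorContract_comm (ξ η : Module.Dual ℝ V) (U : ExteriorAlgebra ℝ V) :
    covectorContract ξ (covectorContract η U) = -covectorContract η (covectorContract ξ U) :=
  CliffordAlgebra.contractLeft_comm ..

theorem covectorContract_one (ξ : Module.Dual ℝ V) :
    covectorContract ξ (1 : ExteriorAlgebra ℝ V) = 0 :=
  CliffordAlgebra.contractLeft_one ..

theorem covectorContract_sum_smul {ι : Type*} (s : Finset ι) (c : ι → ℝ)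
    (ξ : ι → Module.Dual ℝ V) (U : ExteriorAlgebra ℝ V) :
    covectorContract (∑ i ∈ s, c i • ξ i) U = ∑ i ∈ s, c i • covectorContract (ξ i) U := by
  simp only [covectorContract, map_sum, map_smul, LinearMap.sum_apply, LinearMap.smul_apply]

theorem basis_sum_coord_smul {ι : Type*} [Fintype ι] (b : Module.Basis ι ℝ V)
    (ξ : Module.Dual ℝ V) : ∑ a, ξ (b a) • b.coord a = ξ := by
  classical
  refine b.ext fun i => ?_
  simp only [LinearMap.sum_apply, LinearMap.smul_apply, Module.Basis.coord_apply,
    Module.Basis.repr_self, Finsupp.single_apply, smul_eq_mul, mul_ite, mul_one, mul_zero,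
    Finset.sum_ite_eq, Finset.mem_univ, if_true]

@[simp] theorem wedge_nil : wedge ([] : List V) = 1 := rfl

@[simp] theorem wedge_cons (v : V) (l : List V) :
    wedge (v :: l) = ExteriorAlgebra.ι ℝ v * wedge l := by
  simp [wedge]

theorem ι_mul_mem {k : ℕ} (v : V) {U : ExteriorAlgebra ℝ V} (hU : U ∈ ⋀[ℝ]^k V) :
    ExteriorAlgebra.ι ℝ v * U ∈ ⋀[ℝ]^(k + 1) V := by
  have h : ⋀[ℝ]^(k + 1) V = LinearMap.range (ExteriorAlgebra.ι ℝ) * ⋀[ℝ]^k V := pow_succ' _ _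
  rw [h]
  exact Submodule.mul_mem_mul (LinearMap.mem_range_self _ v) hU

theorem wedge_mem (l : List V) : wedge l ∈ ⋀[ℝ]^l.length V := by
  induction l with
  | nil => simp
  | cons v l ih => simpa using ι_mul_mem v ih

/-- Contraction of a decomposable multivector with a covector. -/
theorem covectorContract_wedge_map {ι : Type*} (ξ : Module.Dual ℝ V) (v : ι → V) (l : List ι) :
    covectorContract ξ (wedge (l.map v)) =
      ∑ j : Fin l.length, ((-1) ^ (j : ℕ) * ξ (v (l.get j))) • wedge ((l.eraseIdx j).map v) := by
  induction l with
  | nil => simp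
  | cons i l ih =>
    rw [List.map_cons, wedge_cons, covectorContract_ι_mul, ih]
    simp only [List.length_cons, Fin.sum_univ_succ]
    simp [Finset.mul_sum, sub_eq_add_neg, pow_succ]

/-- Iterated contraction with the covectors `ξ₀, …, ξₚ₋₁`, in this order. -/
def iterContract : {p : ℕ} → (Fin p → Module.Dual ℝ V) →
    ExteriorAlgebra ℝ V →ₗ[ℝ] ExteriorAlgebra ℝ V
  | 0, _ => LinearMap.id
  | _ + 1, ξ => (iterContract (Fin.tail ξ)).comp (covectorContract (ξ 0))

theorem iterContract_zero (ξ : Fin 0 → Module.Dual ℝ V) (U : ExteriorAlgebra ℝ V) :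
    iterContract ξ U = U := rfl

theorem iterContract_succ {p : ℕ} (ξ : Fin (p + 1) → Module.Dual ℝ V) (U : ExteriorAlgebra ℝ V) :
    iterContract ξ U = iterContract (Fin.tail ξ) (covectorContract (ξ 0) U) := rfl

theorem iterContract_eq_foldl {p : ℕ} {ι : Type*} (c : ι → Module.Dual ℝ V) (i : Fin p → ι)
    (U : ExteriorAlgebra ℝ V) :
    (List.ofFn i).foldl (fun W j => CliffordAlgebra.contractLeft (c j) W) U =
      iterContract (fun j => c (i j)) U := by
  induction p generalizing U with
  | zero => simp [iterContract_zero]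
  | succ p ih =>
    rw [List.ofFn_succ, List.foldl_cons, ih, iterContract_succ]
    rfl

theorem iterContract_covectorContract {p : ℕ} (ξ : Fin p → Module.Dual ℝ V)
    (η : Module.Dual ℝ V) (U : ExteriorAlgebra ℝ V) :
    iterContract ξ (covectorContract η U) =
      (-1 : ℝ) ^ p • covectorContract η (iterContract ξ U) := by
  induction p generalizing U with
  | zero => simp [iterContract_zero]
  | succ p ih =>
    rw [iterContract_succ, covectorContract_comm, map_neg, ih, ← iterContract_succ, pow_succ]
    simp

/-- The contraction with η has to pass the p - l later ones to become the last, and each exchange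
costs a sign. Splitting the sign over the two sides avoids a subtraction in the exponent. -/
theorem iterContract_insertNth {p : ℕ} (l : Fin (p + 1)) (η : Module.Dual ℝ V)
    (ξ : Fin p → Module.Dual ℝ V) (U : ExteriorAlgebra ℝ V) :
    (-1 : ℝ) ^ (l : ℕ) • iterContract (l.insertNth η ξ) U =
      (-1 : ℝ) ^ p • covectorContract η (iterContract ξ U) := by
  induction p generalizing U with
  | zero =>
    obtain rfl : l = 0 := Subsingleton.elim (α := Fin 1) l 0
    simp [iterContract_succ, iterContract_zero]
  | succ p ih =>
    refine Fin.cases ?_ (fun l => ?_) l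
    · rw [Fin.insertNth_zero', iterContract_succ, Fin.tail_cons, Fin.cons_zero,
        iterContract_covectorContract]
      simp
    · have h0 : (l.succ.insertNth η ξ : Fin (p + 1 + 1) → Module.Dual ℝ V) 0 = ξ 0 := by
        simp [Fin.insertNth_apply_below]
      have ht : Fin.tail (l.succ.insertNth η ξ : Fin (p + 1 + 1) → Module.Dual ℝ V) =
          l.insertNth η (Fin.tail ξ) := by
        funext j
        refine Fin.succAboveCases l ?_ (fun j => ?_) j
        · simp [Fin.tail]
        · simp only [Fin.tail, Fin.insertNth_apply_succAbove, ← Fin.succ_succAbove_succ]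
      have := ih l (Fin.tail ξ) (covectorContract (ξ 0) U)
      rw [iterContract_succ (l.succ.insertNth η ξ), iterContract_succ ξ, h0, ht, Fin.val_succ,
        pow_succ, pow_succ, mul_smul, mul_smul,
        smul_comm _ (-1 : ℝ), this, smul_comm _ (-1 : ℝ)]

/-- Each contraction is an antiderivation: either v passes through all of them, or exactly one of
them consumes it. -/
theorem iterContract_ι_mul {p : ℕ} (ξ : Fin (p + 1) → Module.Dual ℝ V) (v : V)
    (U : ExteriorAlgebra ℝ V) :
    iterContract ξ (ExteriorAlgebra.ι ℝ v * U) =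
      (-1 : ℝ) ^ (p + 1) • (ExteriorAlgebra.ι ℝ v * iterContract ξ U) +
        ∑ l : Fin (p + 1), ((-1) ^ (l : ℕ) * ξ l v) • iterContract (l.removeNth ξ) U := by
  induction p generalizing U with
  | zero =>
    simp only [iterContract_succ, iterContract_zero, covectorContract_ι_mul]
    simp [sub_eq_add_neg, add_comm]
  | succ p ih =>
    rw [iterContract_succ, covectorContract_ι_mul, map_sub, map_smul, ih,
      Fin.sum_univ_succ fun l => ((-1) ^ (l : ℕ) * ξ l v) • iterContract (l.removeNth ξ) U,
      iterContract_succ ξ]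
    have h : ∀ l : Fin (p + 1), iterContract (l.succ.removeNth ξ) U =
        iterContract (l.removeNth (Fin.tail ξ)) (covectorContract (ξ 0) U) := by
      intro l
      have ht : Fin.tail (l.succ.removeNth ξ) = l.removeNth (Fin.tail ξ) := by
        funext j
        simp only [Fin.tail, Fin.removeNth, Fin.succ_succAbove_succ]
      rw [iterContract_succ, ht]
      rfl
    have h0 : (0 : Fin (p + 2)).removeNth ξ = Fin.tail ξ := rfl
    simp only [h, h0, Fin.val_succ, pow_succ, Fin.val_zero, mul_neg, mul_one, neg_mul, neg_smul,
      Finset.sum_neg_distrib]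
    simp only [Fin.tail, pow_zero, one_mul]
    abel

theorem wedge_ofFn {p : ℕ} (v : Fin p → V) :
    wedge (List.ofFn v) = ExteriorAlgebra.ιMulti ℝ p v := by
  rw [ExteriorAlgebra.ιMulti_apply, wedge, List.map_ofFn]; rfl

theorem wedge_basis_ne_zero {n : ℕ} (b : Module.Basis (Fin n) ℝ V) :
    wedge (List.ofFn b) ≠ 0 := by
  intro h
  -- The determinant of `b`, placed in degree n and zero elsewhere, extends to a functional on the
  -- exterior algebra that is 1 on this wedge.
  have := congrArg (ExteriorAlgebra.liftAlternating (R := ℝ) (N := ℝ) (Pi.single n b.det)) h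
  rw [wedge_ofFn, ExteriorAlgebra.liftAlternating_apply_ιMulti] at this
  rw [Pi.single_eq_same, Module.Basis.det_self, map_zero] at this
  exact one_ne_zero this

end LinearAlgebra

/-! ### Contraction with alternating forms of arbitrary degree -/

section FiniteDimensional

variable {V : Type*} [AddCommGroup V] [Module ℝ V] [FiniteDimensional ℝ V]

theorem contract_eq_iterContract {p : ℕ} (θ : (Fin p → V) → ℝ) (U : ExteriorAlgebra ℝ V) :
    contract θ U = ((p.factorial : ℝ))⁻¹ • ∑ i : Fin p → Fin (Module.finrank ℝ V),
      θ (fun j => Module.finBasis ℝ V (i j)) •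
        iterContract (fun j => (Module.finBasis ℝ V).coord (i j)) U := by
  simp only [contract, iterContract_eq_foldl]

theorem contract_add_right {p : ℕ} (θ : (Fin p → V) → ℝ) (U W : ExteriorAlgebra ℝ V) :
    contract θ (U + W) = contract θ U + contract θ W := by
  simp only [contract_eq_iterContract, map_add, smul_add, Finset.sum_add_distrib]

theorem contract_smul_right {p : ℕ} (θ : (Fin p → V) → ℝ) (c : ℝ) (U : ExteriorAlgebra ℝ V) :
    contract θ (c • U) = c • contract θ U := by
  rw [contract_eq_iterContract, contract_eq_iterContract, smul_comm c]
  congr 1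
  rw [Finset.smul_sum]
  exact Finset.sum_congr rfl fun i _ => by rw [map_smul, smul_comm]

theorem contract_zero_right {p : ℕ} (θ : (Fin p → V) → ℝ) :
    contract θ (0 : ExteriorAlgebra ℝ V) = 0 := by
  simpa using contract_smul_right θ 0 (0 : ExteriorAlgebra ℝ V)

theorem contract_fin_zero (θ : (Fin 0 → V) → ℝ) (U : ExteriorAlgebra ℝ V) :
    contract θ U = θ 0 • U := by
  have h : (fun j => Module.finBasis ℝ V ((default : Fin 0 → Fin (Module.finrank ℝ V)) j)) = 0 :=
    Subsingleton.elim _ _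
  simp only [contract_eq_iterContract, iterContract_zero, Fintype.sum_unique, h]
  simp

/-- Sums over tuples of basis indices, split off at the `l`-th place. -/
theorem sum_tuple_insertNth {n p : ℕ} {W : Type*} [AddCommMonoid W] (l : Fin (p + 1))
    (f : (Fin (p + 1) → Fin n) → W) :
    ∑ i, f i = ∑ i : Fin p → Fin n, ∑ a, f (l.insertNth a i) := by
  rw [← (Fin.insertNthEquiv (fun _ => Fin n) l).sum_comp, Fintype.sum_prod_type, Finset.sum_comm]
  rfl

/-- In the chosen normalization one contracts with ξ before θ; the sign comes from moving ξ past p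
covectors. Each of the p + 1 positions of ξ in the wedge contributes the same sum (`key`), which
turns 1/(p + 1)! into 1/p!. -/
theorem contract_covectorWedge {p : ℕ} (ξ : Module.Dual ℝ V) (θ : (Fin p → V) → ℝ)
    (U : ExteriorAlgebra ℝ V) :
    contract (covectorWedge ξ θ) U = (-1 : ℝ) ^ p • covectorContract ξ (contract θ U) := by
  set e := Module.finBasis ℝ V
  have key : ∀ l : Fin (p + 1), (∑ i : Fin (p + 1) → Fin (Module.finrank ℝ V),
      ((-1) ^ (l : ℕ) * ξ (e (i l)) * θ (l.removeNth fun j => e (i j))) •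
        iterContract (fun j => e.coord (i j)) U) =
      (-1 : ℝ) ^ p • covectorContract ξ (∑ i : Fin p → Fin (Module.finrank ℝ V),
        θ (fun j => e (i j)) • iterContract (fun j => e.coord (i j)) U) := by
    intro l
    rw [sum_tuple_insertNth l, map_sum, Finset.smul_sum]
    refine Finset.sum_congr rfl fun i _ => ?_
    have h1 : ∀ a, (fun j => e.coord ((l.insertNth a i : Fin (p + 1) → _) j)) =
        (l.insertNth (e.coord a) (fun j => e.coord (i j)) : Fin (p + 1) → _) := by
      intro a; funext j
      refine Fin.succAboveCases l ?_ (fun j => ?_) j <;> simp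
    have h2 : ∀ a, (l.removeNth fun j => e ((l.insertNth a i : Fin (p + 1) → _) j)) =
        fun j => e (i j) := by
      intro a; funext j; simp [Fin.removeNth]
    have h3 : ∀ a, ((-1) ^ (l : ℕ) * ξ (e a) * θ (fun j => e (i j))) •
        iterContract (l.insertNth (e.coord a) (fun j => e.coord (i j))) U =
        (-1 : ℝ) ^ p • θ (fun j => e (i j)) • ξ (e a) • covectorContract (e.coord a)
          (iterContract (fun j => e.coord (i j)) U) := by
      intro a
      rw [mul_assoc, mul_comm, mul_smul, iterContract_insertNth, smul_comm, mul_comm, mul_smul]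
    simp only [h1, h2, Fin.insertNth_apply_same, h3]
    rw [← Finset.smul_sum, ← Finset.smul_sum, ← covectorContract_sum_smul,
      basis_sum_coord_smul, map_smul]
  rw [contract_eq_iterContract, contract_eq_iterContract]
  simp only [covectorWedge, Finset.sum_smul]
  rw [Finset.sum_comm]
  have key' := Finset.sum_congr (rfl : (Finset.univ : Finset (Fin (p + 1))) = _) fun l _ => key l
  refine (congrArg _ key').trans ?_
  rw [Finset.sum_const, Finset.card_univ, Fintype.card_fin, map_smul, ← Nat.cast_smul_eq_nsmul ℝ,
    smul_smul, smul_smul, smul_smul, Nat.factorial_succ]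
  congr 1
  have : ((p : ℝ) + 1) ≠ 0 := by positivity
  have : ((p.factorial : ℝ)) ≠ 0 := by positivity
  push_cast
  field_simp

/-- This is the recursion through which contractions are computed. Because θ alternates, its p + 1
slots give equal contributions when v is absorbed, so again (p + 1)! becomes p!. -/
theorem contract_ι_mul {p : ℕ} (θ : V [⋀^Fin (p + 1)]→ₗ[ℝ] ℝ) (v : V) (U : ExteriorAlgebra ℝ V) :
    contract θ (ExteriorAlgebra.ι ℝ v * U) =
      (-1 : ℝ) ^ (p + 1) • (ExteriorAlgebra.ι ℝ v * contract θ U) +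
        contract (θ.curryLeft v) U := by
  set e := Module.finBasis ℝ V
  have key : ∀ l : Fin (p + 1), (∑ i : Fin (p + 1) → Fin (Module.finrank ℝ V),
      θ (fun j => e (i j)) • ((-1) ^ (l : ℕ) * e.coord (i l) v) •
        iterContract (l.removeNth fun j => e.coord (i j)) U) =
      ∑ i : Fin p → Fin (Module.finrank ℝ V),
        θ.curryLeft v (fun j => e (i j)) • iterContract (fun j => e.coord (i j)) U := by
    intro l
    rw [sum_tuple_insertNth l]
    refine Finset.sum_congr rfl fun i _ => ?_
    have h1 : ∀ a, (fun j => e ((l.insertNth a i : Fin (p + 1) → _) j)) =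
        (l.insertNth (e a) (fun j => e (i j)) : Fin (p + 1) → _) := by
      intro a; funext j
      refine Fin.succAboveCases l ?_ (fun j => ?_) j <;> simp
    have h2 : ∀ a, (l.removeNth fun j => e.coord ((l.insertNth a i : Fin (p + 1) → _) j)) =
        fun j => e.coord (i j) := by
      intro a; funext j; simp [Fin.removeNth]
    simp only [h1, h2, Fin.insertNth_apply_same, smul_smul, ← Finset.sum_smul]
    congr 1
    have h3 : ∀ a, θ (l.insertNth (e a) fun j => e (i j)) * ((-1) ^ (l : ℕ) * e.coord a v) =
        e.coord a v * θ.curryLeft (e a) (fun j => e (i j)) := by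
      intro a
      rw [← mul_assoc, mul_comm, AlternatingMap.curryLeft_apply_apply]
      congr 1
      have := θ.neg_one_pow_smul_map_insertNth l (e a) (fun j => e (i j))
      simpa [mul_comm] using this
    simp only [h3]
    let T : V →ₗ[ℝ] ℝ :=
      { toFun := fun w => θ.curryLeft w (fun j => e (i j))
        map_add' := fun w w' => by rw [map_add, AlternatingMap.add_apply]
        map_smul' := fun c w => by rw [map_smul, AlternatingMap.smul_apply]; rfl }
    change ∑ a, e.repr v a • T (e a) = T v
    conv_rhs => rw [← e.sum_repr v, map_sum]
    simp only [map_smul]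
  rw [contract_eq_iterContract, contract_eq_iterContract, contract_eq_iterContract]
  simp only [iterContract_ι_mul, smul_add, Finset.smul_sum, Finset.sum_add_distrib]
  congr 1
  · simp only [Finset.mul_sum, Finset.smul_sum, mul_smul_comm]
    simp only [smul_comm ((-1 : ℝ) ^ (p + 1))]
  · rw [Finset.sum_comm]
    simp only [← Finset.smul_sum]
    rw [Finset.sum_congr rfl fun l _ => key l, Finset.sum_const, Finset.card_univ,
      Fintype.card_fin, ← Nat.cast_smul_eq_nsmul ℝ, smul_smul, Nat.factorial_succ]
    congr 1
    have : ((p : ℝ) + 1) ≠ 0 := by positivity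
    have : ((p.factorial : ℝ)) ≠ 0 := by positivity
    push_cast
    field_simp

theorem contract_fin_one (ξ : Module.Dual ℝ V) (U : ExteriorAlgebra ℝ V) :
    contract (fun v : Fin 1 → V => ξ (v 0)) U = covectorContract ξ U := by
  -- A covector is its own wedge with the constant 0-form 1.
  have h := contract_covectorWedge ξ (fun _ : Fin 0 → V => (1 : ℝ)) U
  have h1 : covectorWedge ξ (fun _ : Fin 0 → V => (1 : ℝ)) = fun v => ξ (v 0) := by
    funext v; simp [covectorWedge]
  rw [h1, contract_fin_zero] at h
  simpa using h

theorem exteriorPower_eq_bot_of_finrank_lt {k : ℕ} (hk : Module.finrank ℝ V < k) :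
    ⋀[ℝ]^k V = ⊥ := by
  rw [← Submodule.finrank_eq_zero (R := ℝ), exteriorPower.finrank_eq, Nat.choose_eq_zero_of_lt hk]

theorem ι_mul_eq_zero_of_mem_top {Λ : ExteriorAlgebra ℝ V}
    (hΛ : Λ ∈ ⋀[ℝ]^(Module.finrank ℝ V) V) (v : V) : ExteriorAlgebra.ι ℝ v * Λ = 0 := by
  have h := ι_mul_mem v hΛ
  rwa [exteriorPower_eq_bot_of_finrank_lt (Nat.lt_succ_self _), Submodule.mem_bot] at h

/-- Since v ∧ Λ = 0 in top degree, `contract_ι_mul` passes the vanishing from θ to every i_v θ, and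
induction on the degree applies. -/
theorem eq_zero_of_contract_top_eq_zero {p : ℕ} {Λ : ExteriorAlgebra ℝ V}
    (hΛ : Λ ∈ ⋀[ℝ]^(Module.finrank ℝ V) V) (h0 : Λ ≠ 0) (θ : V [⋀^Fin p]→ₗ[ℝ] ℝ)
    (h : contract θ Λ = 0) : θ = 0 := by
  induction p with
  | zero =>
    rw [contract_fin_zero, smul_eq_zero_iff_left h0] at h
    ext v
    rw [Subsingleton.elim v 0, h]; rfl
  | succ p ih =>
    have hv : ∀ v, θ.curryLeft v = 0 := fun v => ih _ <| by
      simpa [ι_mul_eq_zero_of_mem_top hΛ, h, contract_zero_right] using (contract_ι_mul θ v Λ).symm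
    ext v
    have := congrArg (fun f => f (Fin.tail v)) (hv (v 0))
    simpa [AlternatingMap.curryLeft_apply_apply, Matrix.vecCons] using this

theorem exists_smul_eq_of_mem_top {Λ Λ' : ExteriorAlgebra ℝ V}
    (hΛ : Λ ∈ ⋀[ℝ]^(Module.finrank ℝ V) V) (h0 : Λ ≠ 0)
    (hΛ' : Λ' ∈ ⋀[ℝ]^(Module.finrank ℝ V) V) : ∃ c : ℝ, c • Λ = Λ' := by
  have h1 : Module.finrank ℝ (⋀[ℝ]^(Module.finrank ℝ V) V) = 1 := by
    rw [exteriorPower.finrank_eq, Nat.choose_self]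
  obtain ⟨c, hc⟩ := (finrank_eq_one_iff_of_nonzero' (⟨Λ, hΛ⟩ : ⋀[ℝ]^(Module.finrank ℝ V) V)
    (by simpa using h0)).1 h1 ⟨Λ', hΛ'⟩
  exact ⟨c, congrArg Subtype.val hc⟩

end FiniteDimensional

/-! ### Multivector fields: functions, sections, and localization -/

section Fields

variable {E : Type*} [NormedAddCommGroup E] [NormedSpace ℝ E]
  {M : Type*} [TopologicalSpace M] [ChartedSpace E M]
  {F : Type*} [NormedAddCommGroup F] [NormedSpace ℝ F]
  {A : M → Type*} [TopologicalSpace (Bundle.TotalSpace F A)] [∀ x, TopologicalSpace (A x)]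
  [∀ x, AddCommGroup (A x)] [∀ x, Module ℝ (A x)]
  [FiberBundle F A] [VectorBundle ℝ F A]

@[simp] theorem fnSmul_apply (f : Fn E M) (X : Sec E F A) (x : M) : fnSmul f X x = f x • X x := rfl

/-- The value of a multivector field at a point. -/
def evalAt (x : M) : MultiField E F A →ₐ[ℝ] ExteriorAlgebra ℝ (A x) :=
  (Pi.evalAlgHom ℝ (fun x : M => ExteriorAlgebra ℝ (A x)) x).comp (smoothMultivectors E F A).val

theorem MultiField.ext {U W : MultiField E F A} (h : ∀ x, evalAt x U = evalAt x W) : U = W :=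
  Subtype.ext (funext h)

theorem mem_grade_iff {k : ℕ} {U : MultiField E F A} :
    U ∈ MultiField.grade E F A k ↔ ∀ x, evalAt x U ∈ ⋀[ℝ]^k (A x) := Iff.rfl

/-- A smooth function as a multivector field of degree `0`. -/
def ofFn (f : Fn E M) : MultiField E F A :=
  ⟨fun x => algebraMap ℝ _ (f x), fun _ => ⟨[(f, [])], Filter.Eventually.of_forall fun y => by
    simp [evalTerms, Algebra.algebraMap_eq_smul_one]⟩⟩

/-- A smooth section as a multivector field of degree `1`. -/
def ofSec (X : Sec E F A) : MultiField E F A :=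
  ⟨fun x => ExteriorAlgebra.ι ℝ (X x), fun _ => ⟨[(1, [X])], Filter.Eventually.of_forall fun y => by
    simp [evalTerms]⟩⟩

/-- The multivector field `X₁ ∧ ⋯ ∧ Xₖ`. -/
def ofList (l : List (Sec E F A)) : MultiField E F A := (l.map ofSec).prod

@[simp] theorem evalAt_ofFn (f : Fn E M) (x : M) :
    evalAt x (ofFn f : MultiField E F A) = algebraMap ℝ _ (f x) := rfl

theorem evalAt_ofFn_mul (f : Fn E M) (U : MultiField E F A) (x : M) :
    evalAt x (ofFn f * U) = f x • evalAt x U := by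
  rw [map_mul, evalAt_ofFn, Algebra.smul_def]

@[simp] theorem evalAt_ofSec (X : Sec E F A) (x : M) :
    evalAt x (ofSec X) = ExteriorAlgebra.ι ℝ (X x) := rfl

theorem ofList_cons (X : Sec E F A) (l : List (Sec E F A)) :
    ofList (X :: l) = ofSec X * ofList l := by simp [ofList]

theorem evalAt_ofList (l : List (Sec E F A)) (x : M) :
    evalAt x (ofList l) = wedge (l.map fun X => X x) := by
  induction l with
  | nil => exact map_one _
  | cons X l ih => simp [ofList_cons, ih]

theorem ofFn_mem_grade (f : Fn E M) : (ofFn f : MultiField E F A) ∈ MultiField.grade E F A 0 :=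
  fun x => by
    have h : ⋀[ℝ]^0 (A x) = 1 := pow_zero _
    rw [h]
    exact Submodule.mem_one.2 ⟨f x, rfl⟩

theorem ofList_mem_grade (l : List (Sec E F A)) :
    ofList l ∈ MultiField.grade E F A l.length := mem_grade_iff.2 fun x => by
  have := wedge_mem (l.map fun X => X x)
  rwa [List.length_map, ← evalAt_ofList] at this

theorem ofSec_mem_grade (X : Sec E F A) : ofSec X ∈ MultiField.grade E F A 1 := by
  simpa [ofList] using ofList_mem_grade [X]

theorem exists_eventually_evalAt_eq (U : MultiField E F A) (x : M) :
    ∃ S : List (Fn E M × List (Sec E F A)), ∀ᶠ y in 𝓝 x, evalAt y U = evalTerms S y :=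
  U.2 x

/-- A multivector field of degree `0` is a function. -/
theorem exists_eq_ofFn {U : MultiField E F A} (hU : U ∈ MultiField.grade E F A 0) :
    ∃ f : Fn E M, U = ofFn f := by
  have key : ∀ x, algebraMap ℝ _ (ExteriorAlgebra.algebraMapInv (evalAt x U)) = evalAt x U := by
    intro x
    have h0 : ⋀[ℝ]^0 (A x) = 1 := pow_zero _
    have h := mem_grade_iff.1 hU x
    rw [h0] at h
    obtain ⟨r, hr⟩ := Submodule.mem_one.1 h
    rw [← hr, ExteriorAlgebra.algebraMap_leftInverse]
  refine ⟨⟨fun x => ExteriorAlgebra.algebraMapInv (evalAt x U), fun x => ?_⟩,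
    MultiField.ext fun x => (key x).symm⟩
  obtain ⟨S, hS⟩ := exists_eventually_evalAt_eq U x
  -- The scalar part of a local expansion is the sum of the coefficients that multiply empty wedges,
  -- hence smooth.
  have hT : ∀ T : List (Fn E M × List (Sec E F A)), ContMDiff 𝓘(ℝ, E) 𝓘(ℝ, ℝ) ∞
      fun y => ExteriorAlgebra.algebraMapInv (evalTerms T y) := by
    intro T
    induction T with
    | nil => simpa [evalTerms] using contMDiff_const
    | cons t T ih =>
      have : (fun y => ExteriorAlgebra.algebraMapInv (evalTerms (t :: T) y)) = fun y =>
          t.1 y * (if t.2 = [] then 1 else 0) +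
            ExteriorAlgebra.algebraMapInv (evalTerms T y) := by
        funext y
        rcases t with ⟨f, _ | ⟨Y, l⟩⟩
        · simp [evalTerms]
        · have h0 : ExteriorAlgebra.algebraMapInv (ExteriorAlgebra.ι ℝ (Y y)) = 0 := by
            simp [ExteriorAlgebra.algebraMapInv]
          simp [evalTerms, h0]
      rw [this]
      exact (t.1.contMDiff.mul contMDiff_const).add ih
  refine (hT S x).congr_of_eventuallyEq ?_
  filter_upwards [hS] with y hy
  rw [hy]

/-! ### Forms of degree one -/

/-- The covector at `x` given by a `1`-form. -/
def Form.covector (α : Form E F A 1) (x : M) : Module.Dual ℝ (A x) :=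
  (AlternatingMap.ofSubsingleton ℝ (A x) ℝ (0 : Fin 1)).symm (α.toFun x)

theorem Form.covector_apply (α : Form E F A 1) (x : M) (v : A x) :
    α.covector x v = α.toFun x (fun _ => v) := rfl

theorem Form.toFun_eq_covector (α : Form E F A 1) (x : M) :
    ⇑(α.toFun x) = fun v => α.covector x (v 0) := by
  funext v
  rw [Form.covector_apply]
  congr 1
  funext i
  rw [Subsingleton.elim i 0]

/-- The function `⟨α, X⟩`. -/
def Form.pair (α : Form E F A 1) (X : Sec E F A) : Fn E M :=
  ⟨fun x => α.covector x (X x), α.smooth fun _ => X⟩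

@[simp] theorem Form.pair_apply (α : Form E F A 1) (X : Sec E F A) (x : M) :
    α.pair X x = α.covector x (X x) := rfl

theorem contractAt_one [FiniteDimensional ℝ F] (α : Form E F A 1) (x : M)
    (U : ExteriorAlgebra ℝ (A x)) :
    contractAt F x (α.toFun x) U = covectorContract (α.covector x) U := by
  have : FiniteDimensional ℝ (A x) := VectorBundle.finiteDimensional ℝ F A x
  rw [Form.toFun_eq_covector]
  exact contract_fin_one (α.covector x) U

/-! ### Cut-off functions and tensoriality -/

variable [FiniteDimensional ℝ E] [T2Space M] [IsManifold 𝓘(ℝ, E) ∞ M]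

theorem exists_cutoff {x : M} {s : Set M} (hs : s ∈ 𝓝 x) :
    ∃ ψ : Fn E M, (∀ᶠ y in 𝓝 x, ψ y = 1) ∧ tsupport ψ ⊆ s := by
  obtain ⟨ψ, -, hψ⟩ := (SmoothBumpFunction.nhds_basis_tsupport (I := 𝓘(ℝ, E)) x).mem_iff.1 hs
  exact ⟨⟨ψ, ψ.contMDiff⟩, ψ.eventuallyEq_one, hψ⟩

variable [ContMDiffVectorBundle ∞ F A 𝓘(ℝ, E)]

@[simp] theorem sectionThrough_apply {x : M} (v : A x) : sectionThrough E F v x = v :=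
  (exists_section x v).choose_spec

/-- The coefficients come from the frame of a local trivialization and inherit the zero of X at x.
Both coefficients and frame are multiplied by a cut-off, which makes them global and changes nothing
where it equals 1. -/
theorem exists_local_expansion [FiniteDimensional ℝ F] (x : M) (X : Sec E F A) (hX : X x = 0) :
    ∃ (f : Fin (Module.finrank ℝ F) → Fn E M) (e : Fin (Module.finrank ℝ F) → Sec E F A),
      (∀ i, f i x = 0) ∧ ∀ᶠ y in 𝓝 x, X y = ∑ i, f i y • e i y := by
  set t := trivializationAt F A x
  set b := Module.finBasis ℝ F
  have hx : x ∈ t.baseSet := FiberBundle.mem_baseSet_trivializationAt' x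
  obtain ⟨ψ, hψ1, hψ⟩ := exists_cutoff (E := E) (t.open_baseSet.mem_nhds hx)
  have hc : ∀ i, ∀ y ∈ t.baseSet, ContMDiffAt 𝓘(ℝ, E) 𝓘(ℝ, ℝ) ∞
      (fun y => t.localFrameCoeff 𝓘(ℝ, E) b i y (X y)) y := fun i y hy =>
    contMDiffAt_localFrameCoeff (k := ∞) b hy (X.contMDiff y) i
  refine ⟨fun i => ⟨fun y => ψ y * t.localFrameCoeff 𝓘(ℝ, E) b i y (X y), ?_⟩,
    fun i => ⟨(fun y => ψ y) • t.localFrame b i, ?_⟩, fun i => ?_, ?_⟩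
  · refine contMDiff_of_tsupport fun y hy => ?_
    have hy' : y ∈ tsupport ψ := tsupport_mul_subset_left hy
    exact (ψ.contMDiff y).mul (hc i y (hψ hy'))
  · exact (ψ.contMDiff.contMDiffOn).smul_section_of_tsupport t.open_baseSet hψ
      (t.contMDiffOn_localFrame_baseSet ∞ b i)
  · show ψ x * t.localFrameCoeff 𝓘(ℝ, E) b i x (X x) = 0
    rw [hX, map_zero, mul_zero]
  · filter_upwards [hψ1, t.eventually_eq_localFrame_sum_coeff_smul (I := 𝓘(ℝ, E)) (s := X) b hx]
      with y h1 h2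
    refine h2.trans (Finset.sum_congr rfl fun i _ => ?_)
    show _ = (ψ y * t.localFrameCoeff 𝓘(ℝ, E) b i y (X y)) • (ψ y • t.localFrame b i y)
    rw [h1, one_mul, one_smul]

/-- An operator on sections that is linear over the smooth functions depends only on the values of
the sections. -/
theorem tensorial_congr [FiniteDimensional ℝ F] {W : Type*} [AddCommGroup W] [Module ℝ W] {x : M}
    (T : Sec E F A →ₗ[ℝ] W) (hT : ∀ f X, T (fnSmul f X) = f x • T X) {X Y : Sec E F A}
    (h : X x = Y x) : T X = T Y := by
  rw [← sub_eq_zero, ← map_sub]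
  obtain ⟨f, e, hf, he⟩ := exists_local_expansion x (X - Y) (by simp [h])
  obtain ⟨ψ, hψ1, hψ⟩ := exists_cutoff (E := E) he
  -- A second cut-off turns the local expansion into a global identity of sections, to which `T` can
  -- be applied; at x the factor ψ is 1 and every f i is 0.
  have key : fnSmul ψ (X - Y) = ∑ i, fnSmul (ψ * f i) (e i) := by
    ext y
    have h1 : (∑ i, fnSmul (ψ * f i) (e i)) y = ∑ i, (ψ y * f i y) • e i y :=
      (map_sum ((Pi.evalAddMonoidHom _ y).comp (ContMDiffSection.coeAddHom _ _ _ _)) _ _)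
    rw [h1, fnSmul_apply]
    simp only [mul_smul, ← Finset.smul_sum]
    by_cases hy : y ∈ tsupport ψ
    · congr 1; exact hψ hy
    · rw [image_eq_zero_of_notMem_tsupport hy, zero_smul, zero_smul]
  have := congrArg T key
  rw [hT, hψ1.self_of_nhds, one_smul, map_sum] at this
  rw [this]
  exact Finset.sum_eq_zero fun i _ => by
    rw [hT]
    show (ψ x * f i x) • _ = _
    rw [hf, mul_zero, zero_smul]

/-- The linear map on the fibre that is induced by an operator on sections which is linear over the
smooth functions. -/
def tensorialMap [FiniteDimensional ℝ F] {W : Type*} [AddCommGroup W] [Module ℝ W] {x : M}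
    (T : Sec E F A →ₗ[ℝ] W) (hT : ∀ f X, T (fnSmul f X) = f x • T X) : A x →ₗ[ℝ] W where
  toFun v := T (sectionThrough E F v)
  map_add' v w := by
    rw [← map_add]
    exact tensorial_congr T hT (by simp)
  map_smul' c v := by
    rw [← map_smul]
    exact tensorial_congr T hT (by simp)

theorem tensorialMap_apply [FiniteDimensional ℝ F] {W : Type*} [AddCommGroup W] [Module ℝ W]
    {x : M} (T : Sec E F A →ₗ[ℝ] W) (hT : ∀ f X, T (fnSmul f X) = f x • T X) (X : Sec E F A) :
    tensorialMap T hT (X x) = T X :=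
  tensorial_congr T hT (by simp)

/-- A multivector field agrees near each point with a finite sum of decomposable ones, after
multiplication with a cut-off function. -/
theorem exists_cutoff_mul_eq_sum (U : MultiField E F A) (x : M) :
    ∃ (ψ : Fn E M) (S : List (Fn E M × List (Sec E F A))), ψ x = 1 ∧
      (∀ᶠ y in 𝓝 x, evalAt y U = evalTerms S y) ∧
      ofFn ψ * U = (S.map fun t => ofFn ψ * (ofFn t.1 * ofList t.2)).sum := by
  obtain ⟨S, hS⟩ := exists_eventually_evalAt_eq U x
  obtain ⟨ψ, hψ1, hψ⟩ := exists_cutoff (E := E) hS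
  refine ⟨ψ, S, hψ1.self_of_nhds, hS, MultiField.ext fun y => ?_⟩
  rw [List.sum_map_mul_left, evalAt_ofFn_mul, evalAt_ofFn_mul, map_list_sum, List.map_map]
  by_cases hy : y ∈ tsupport ψ
  · have : evalAt y U = evalTerms S y := hψ hy
    rw [this, evalTerms]
    congr 3
    funext t
    simp only [Function.comp_apply, evalAt_ofFn_mul, evalAt_ofList]
  · rw [image_eq_zero_of_notMem_tsupport hy, zero_smul, zero_smul]

/-- An operator that is linear over the smooth functions is determined by its values on decomposable
multivector fields. -/
theorem evalAt_map_eq_of_forall_ofList {x : M} (P : MultiField E F A →ₗ[ℝ] MultiField E F A)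
    (Q : ExteriorAlgebra ℝ (A x) →ₗ[ℝ] ExteriorAlgebra ℝ (A x))
    (hP : ∀ f U, evalAt x (P (ofFn f * U)) = f x • evalAt x (P U))
    (h : ∀ l, evalAt x (P (ofList l)) = Q (evalAt x (ofList l))) (U : MultiField E F A) :
    evalAt x (P U) = Q (evalAt x U) := by
  obtain ⟨ψ, S, hψ, hS, hU⟩ := exists_cutoff_mul_eq_sum U x
  have h1 := congrArg (fun W => evalAt x (P W)) hU
  simp only [hP, hψ, one_smul, map_list_sum, List.map_map] at h1
  rw [h1, hS.self_of_nhds, evalTerms, map_list_sum, List.map_map]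
  congr 2
  funext t
  simp only [Function.comp_apply, hP, hψ, one_smul, h, map_smul, evalAt_ofList]

end Fields

/-! ### Directional derivatives of real functions -/

section Derivatives

variable {E : Type*} [NormedAddCommGroup E] [NormedSpace ℝ E]
  {M : Type*} [TopologicalSpace M] [ChartedSpace E M]

theorem dirDeriv_mul {f g : M → ℝ} (hf : ContMDiff 𝓘(ℝ, E) 𝓘(ℝ, ℝ) ∞ f)
    (hg : ContMDiff 𝓘(ℝ, E) 𝓘(ℝ, ℝ) ∞ g) (x : M) (v : TangentSpace 𝓘(ℝ, E) x) :
    dirDeriv (fun y => f y * g y) x v = f x * dirDeriv g x v + dirDeriv f x v * g x := by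
  have h := (((hf x).mdifferentiableAt (by simp)).hasMFDerivAt.mul
    ((hg x).mdifferentiableAt (by simp)).hasMFDerivAt).mfderiv
  refine (congrArg (fun T => T v) h).trans ?_
  show f x * dirDeriv g x v + g x * dirDeriv f x v = _
  rw [mul_comm (g x)]

theorem dirDeriv_exp {f : M → ℝ} (hf : ContMDiff 𝓘(ℝ, E) 𝓘(ℝ, ℝ) ∞ f) (x : M)
    (v : TangentSpace 𝓘(ℝ, E) x) :
    dirDeriv (fun y => Real.exp (f y)) x v = Real.exp (f x) * dirDeriv f x v := by
  have h := (HasMFDerivAt.comp x (Real.hasDerivAt_exp (f x)).hasFDerivAt.hasMFDerivAt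
    ((hf x).mdifferentiableAt (by simp)).hasMFDerivAt).mfderiv
  refine (congrArg (fun T => T v) h).trans ?_
  show dirDeriv f x v • Real.exp (f x) = _
  rw [smul_eq_mul, mul_comm]

theorem dirDeriv_const (c : ℝ) (x : M) (v : TangentSpace 𝓘(ℝ, E) x) :
    dirDeriv (fun _ => c) x v = 0 := by
  have h : mfderiv 𝓘(ℝ, E) 𝓘(ℝ, ℝ) (fun _ : M => c) x = 0 := mfderiv_const
  exact congrArg (fun T => T v) h

theorem dirDeriv_congr {f g : M → ℝ} {x : M} (h : f =ᶠ[𝓝 x] g) (v : TangentSpace 𝓘(ℝ, E) x) :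
    dirDeriv f x v = dirDeriv g x v := by
  have h' : mfderiv 𝓘(ℝ, E) 𝓘(ℝ, ℝ) f x = mfderiv 𝓘(ℝ, E) 𝓘(ℝ, ℝ) g x := h.mfderiv_eq
  exact congrArg (fun T => T v) h'

end Derivatives

/-! ### Lie algebroids: one-forms, generating operators, connections -/

section Algebroid

variable {E : Type*} [NormedAddCommGroup E] [NormedSpace ℝ E] [FiniteDimensional ℝ E]
  {M : Type*} [TopologicalSpace M] [T2Space M] [ChartedSpace E M] [IsManifold 𝓘(ℝ, E) ∞ M]
  {F : Type*} [NormedAddCommGroup F] [NormedSpace ℝ F] [FiniteDimensional ℝ F]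
  {A : M → Type*} [TopologicalSpace (Bundle.TotalSpace F A)] [∀ x, TopologicalSpace (A x)]
  [∀ x, AddCommGroup (A x)] [∀ x, Module ℝ (A x)]
  [FiberBundle F A] [VectorBundle ℝ F A] [ContMDiffVectorBundle ∞ F A 𝓘(ℝ, E)]

namespace LieAlgebroid

variable (L : LieAlgebroid E F A)

/-- The covector `df` at `x`. -/
def dFn (f : M → ℝ) (x : M) : Module.Dual ℝ (A x) :=
  (mfderiv 𝓘(ℝ, E) 𝓘(ℝ, ℝ) f x).toLinearMap.comp (L.anchor x)

theorem dFn_apply (f : M → ℝ) (x : M) (v : A x) : L.dFn f x v = dirDeriv f x (L.anchor x v) := rfl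

theorem act_eq_dFn (X : Sec E F A) (f : M → ℝ) (x : M) : L.act X f x = L.dFn f x (X x) := rfl

theorem act_mul (X : Sec E F A) (f g : Fn E M) (x : M) :
    L.act X (fun y => f y * g y) x = f x * L.act X g x + L.act X f x * g x :=
  dirDeriv_mul f.contMDiff g.contMDiff x _

theorem bracket_swap (X Y : Sec E F A) : L.bracket Y X = -L.bracket X Y := by
  have h := L.bracket_self (X + Y)
  simp only [map_add, LinearMap.add_apply, L.bracket_self] at h
  rw [eq_neg_iff_add_eq_zero]
  simpa [add_comm] using h

/-! ### The differential of a form of degree one -/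

/-- The value `(dα)(X, Y) = a(X) ⟨α, Y⟩ - a(Y) ⟨α, X⟩ - ⟨α, [X, Y]⟩` at `x`. -/
def dOneForm (α : Form E F A 1) (x : M) : Sec E F A →ₗ[ℝ] Sec E F A →ₗ[ℝ] ℝ :=
  LinearMap.mk₂ ℝ (fun X Y => L.act X (α.pair Y) x - L.act Y (α.pair X) x -
      α.covector x (L.bracket X Y x))
    (fun X X' Y => by
      have h : L.act Y (α.pair (X + X')) x = L.act Y (α.pair X) x + L.act Y (α.pair X') x := by
        have h1 : (α.pair (X + X') : M → ℝ) = fun y => α.pair X y + α.pair X' y := by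
          funext y; simp
        rw [h1]
        exact dirDeriv_add (α.pair X).contMDiff (α.pair X').contMDiff x _
      simp only [h, act_eq_dFn, map_add, LinearMap.add_apply, ContMDiffSection.coe_add,
        Pi.add_apply]
      ring)
    (fun c X Y => by
      have h : L.act Y (α.pair (c • X)) x = c * L.act Y (α.pair X) x := by
        have h1 : (α.pair (c • X) : M → ℝ) = fun y => c * α.pair X y := by
          funext y; simp
        rw [h1]
        exact dirDeriv_smul c (α.pair X).contMDiff x _
      simp only [h, act_eq_dFn, map_smul, LinearMap.smul_apply, ContMDiffSection.coe_smul,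
        Pi.smul_apply, smul_eq_mul]
      ring)
    (fun X Y Y' => by
      have h : L.act X (α.pair (Y + Y')) x = L.act X (α.pair Y) x + L.act X (α.pair Y') x := by
        have h1 : (α.pair (Y + Y') : M → ℝ) = fun y => α.pair Y y + α.pair Y' y := by
          funext y; simp
        rw [h1]
        exact dirDeriv_add (α.pair Y).contMDiff (α.pair Y').contMDiff x _
      simp only [h, act_eq_dFn, map_add, ContMDiffSection.coe_add, Pi.add_apply]
      ring)
    (fun c X Y => by
      have h : L.act X (α.pair (c • Y)) x = c * L.act X (α.pair Y) x := by
        have h1 : (α.pair (c • Y) : M → ℝ) = fun y => c * α.pair Y y := by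
          funext y; simp
        rw [h1]
        exact dirDeriv_smul c (α.pair Y).contMDiff x _
      simp only [h, act_eq_dFn, map_smul, ContMDiffSection.coe_smul, Pi.smul_apply, smul_eq_mul]
      ring)

theorem dOneForm_apply (α : Form E F A 1) (x : M) (X Y : Sec E F A) :
    L.dOneForm α x X Y = L.act X (α.pair Y) x - L.act Y (α.pair X) x -
      α.covector x (L.bracket X Y x) := rfl

theorem dOneForm_self (α : Form E F A 1) (x : M) (X : Sec E F A) : L.dOneForm α x X X = 0 := by
  simp [dOneForm_apply, L.bracket_self]

theorem dOneForm_swap (α : Form E F A 1) (x : M) (X Y : Sec E F A) :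
    L.dOneForm α x Y X = -L.dOneForm α x X Y := by
  rw [dOneForm_apply, dOneForm_apply, L.bracket_swap X Y]
  simp only [ContMDiffSection.coe_neg, Pi.neg_apply, map_neg]
  ring

/-- The derivative of f enters twice, from a(X)⟨α, fY⟩ and from the Leibniz rule for [X, fY], with
opposite signs. Tensoriality of dα rests on this cancellation. -/
theorem dOneForm_fnSmul_right (α : Form E F A 1) (x : M) (f : Fn E M) (X Y : Sec E F A) :
    L.dOneForm α x X (fnSmul f Y) = f x • L.dOneForm α x X Y := by
  have h : L.act X (α.pair (fnSmul f Y)) x =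
      f x * L.act X (α.pair Y) x + L.act X f x * α.pair Y x := by
    rw [← act_mul]
    congr 1
    funext y
    simp
  rw [dOneForm_apply, dOneForm_apply, h, L.leibniz]
  simp only [act_eq_dFn, fnSmul_apply, map_smul, map_add, Form.pair_apply, smul_eq_mul, dFn_apply]
  ring

theorem dOneForm_fnSmul_left (α : Form E F A 1) (x : M) (f : Fn E M) (X Y : Sec E F A) :
    L.dOneForm α x (fnSmul f X) Y = f x • L.dOneForm α x X Y := by
  rw [dOneForm_swap, dOneForm_fnSmul_right, dOneForm_swap, smul_neg, neg_neg]

/-- The differential of a `1`-form as a bilinear form on the fibre. -/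
def dBilin (α : Form E F A 1) (x : M) : A x →ₗ[ℝ] A x →ₗ[ℝ] ℝ :=
  tensorialMap (E := E) (F := F)
    { toFun := fun X => tensorialMap (L.dOneForm α x X) fun f Y => L.dOneForm_fnSmul_right α x f X Y
      map_add' := fun X X' => by
        ext v
        show L.dOneForm α x (X + X') _ = L.dOneForm α x X _ + L.dOneForm α x X' _
        rw [map_add, LinearMap.add_apply]
      map_smul' := fun c X => by
        ext v
        show L.dOneForm α x (c • X) _ = c • L.dOneForm α x X _
        rw [map_smul, LinearMap.smul_apply] }
    fun f X => by
      ext v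
      exact L.dOneForm_fnSmul_left α x f X _

theorem dBilin_apply (α : Form E F A 1) (x : M) (X Y : Sec E F A) :
    L.dBilin α x (X x) (Y x) = L.dOneForm α x X Y := by
  rw [dBilin, tensorialMap_apply]
  exact tensorialMap_apply (L.dOneForm α x X) (fun f Y => L.dOneForm_fnSmul_right α x f X Y) Y

/-- The differential of a `1`-form as an alternating form on the fibre. -/
def dAlternating (α : Form E F A 1) (x : M) : (A x) [⋀^Fin 2]→ₗ[ℝ] ℝ where
  toFun v := L.dBilin α x (v 0) (v 1)
  map_update_add' v i a b := by fin_cases i <;> simp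
  map_update_smul' v i c a := by fin_cases i <;> simp
  map_eq_zero_of_eq' v i j h hij := by
    have h01 : v 0 = v 1 := by
      fin_cases i <;> fin_cases j <;> first | exact absurd rfl hij | exact h | exact h.symm
    have := L.dOneForm_self α x (sectionThrough E F (v 1))
    rw [← dBilin_apply, sectionThrough_apply] at this
    rw [h01, this]

theorem dAlternating_apply (α : Form E F A 1) (x : M) (v : Fin 2 → A x) :
    L.dAlternating α x v = L.dBilin α x (v 0) (v 1) := rfl

/-- `L.d` is evaluated on chosen sections through the vectors; for a 1-form, tensoriality removes
the choice and lets the recursion for alternating forms be used. -/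
theorem d_eq_dAlternating (α : Form E F A 1) (x : M) : L.d α x = L.dAlternating α x := by
  funext v
  rw [dAlternating_apply]
  conv_rhs => rw [← sectionThrough_apply (E := E) (F := F) (v 0),
    ← sectionThrough_apply (E := E) (F := F) (v 1), dBilin_apply, dOneForm_apply]
  have h : ∀ Y : Sec E F A, (fun y => α.toFun y fun _ => Y y) = α.pair Y := fun Y => rfl
  have h1 : ∀ (Z : Fin 1 → Sec E F A), (fun y => α.toFun y fun l => Z l y) = α.pair (Z 0) := by
    intro Z
    funext y
    rw [Form.toFun_eq_covector]; rfl
  simp only [d, dOnSections, dBracketPart, h1]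
  rw [Form.toFun_eq_covector]
  simp [Fin.removeNth]
  try ring

/-- Together with `contract_d_one` this recursion determines i_{dα} on decomposable multivectors. No
sign appears in front of v because dα has even degree. -/
theorem contract_dAlternating_ι_mul (α : Form E F A 1) (x : M) (v : A x)
    (U : ExteriorAlgebra ℝ (A x)) :
    contractAt F x (L.d α x) (ExteriorAlgebra.ι ℝ v * U) =
      ExteriorAlgebra.ι ℝ v * contractAt F x (L.d α x) U +
        covectorContract (L.dBilin α x v) U := by
  have : FiniteDimensional ℝ (A x) := VectorBundle.finiteDimensional ℝ F A x
  have h := contract_ι_mul (L.dAlternating α x) v U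
  have h1 : ⇑((L.dAlternating α x).curryLeft v) = fun w => L.dBilin α x v (w 0) := rfl
  rw [h1, contract_fin_one] at h
  rw [d_eq_dAlternating]
  simp only [contractAt]
  simpa using h

theorem contract_d_one (α : Form E F A 1) (x : M) :
    contractAt F x (L.d α x) (1 : ExteriorAlgebra ℝ (A x)) = 0 := by
  simp [contractAt, contract, List.ofFn_succ]

theorem isClosedForm_of_contract_eq_zero (α : Form E F A 1)
    (h : ∀ (U : MultiField E F A) x, contractAt F x (L.d α x) (evalAt x U) = 0) :
    L.IsClosedForm α := by
  intro x v
  -- Contracting v₀ ∧ v₁ with dα leaves the scalar dα(v₀, v₁).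
  have h1 := h (ofSec (sectionThrough E F (v 0)) * ofSec (sectionThrough E F (v 1))) x
  have h2 : contractAt F x (L.d α x) (ExteriorAlgebra.ι ℝ (v 1)) = 0 := by
    have := L.contract_dAlternating_ι_mul α x (v 1) 1
    rwa [mul_one, contract_d_one, covectorContract_one, mul_zero, add_zero] at this
  rw [map_mul, evalAt_ofSec, evalAt_ofSec, sectionThrough_apply, sectionThrough_apply,
    contract_dAlternating_ι_mul, h2, mul_zero, zero_add, ← mul_one (ExteriorAlgebra.ι ℝ (v 1)),
    covectorContract_ι_mul, covectorContract_one, mul_zero, sub_zero] at h1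
  have h3 : L.dBilin α x (v 0) (v 1) = 0 := by
    have := congrArg ExteriorAlgebra.algebraMapInv h1
    simpa using this
  rw [d_eq_dAlternating, dAlternating_apply, h3]

/-! ### The Schouten bracket with a function and with a section -/

theorem schoutenTerm_fn (f : Fn E M) (t : Fn E M × List (Sec E F A)) (x : M) :
    L.schoutenTerm (f, []) t x =
      -covectorContract (L.dFn f x) (t.1 x • wedge (t.2.map fun Y => Y x)) := by
  rw [map_smul, covectorContract_wedge_map]
  simp [schoutenTerm, act_eq_dFn]

theorem schoutenTerm_sec (Y : Sec E F A) (g : Fn E M) (l : List (Sec E F A)) (x : M) :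
    L.schoutenTerm (1, [Y]) (g, l) x = g x • ∑ j : Fin l.length, (-1 : ℝ) ^ (j : ℕ) •
        (ExteriorAlgebra.ι ℝ (L.bracket Y (l.get j) x) *
          wedge ((l.eraseIdx j).map fun Z => Z x)) +
      L.act Y g x • wedge (l.map fun Z => Z x) := by
  have h : ∀ Z : Sec E F A, L.act Z (1 : M → ℝ) x = 0 := fun Z => dirDeriv_const 1 x _
  simp [schoutenTerm, h, -List.get_eq_getElem]
  rfl

/-- This is the derivation rule for [Y, ·]. The j = 0 summand supplies [Y, Z]; in the others [Y, Zⱼ]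
is moved past Z, and that sign offsets the shift of the index. -/
theorem schoutenTerm_sec_cons (Y Z : Sec E F A) (g : Fn E M) (l : List (Sec E F A)) (x : M) :
    L.schoutenTerm (1, [Y]) (g, Z :: l) x =
      ExteriorAlgebra.ι ℝ (L.bracket Y Z x) * (g x • wedge (l.map fun Z => Z x)) +
        ExteriorAlgebra.ι ℝ (Z x) * L.schoutenTerm (1, [Y]) (g, l) x := by
  have h : ∀ v w : A x, ExteriorAlgebra.ι ℝ v * ExteriorAlgebra.ι ℝ w =
      -(ExteriorAlgebra.ι ℝ w * ExteriorAlgebra.ι ℝ v) := fun v w =>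
    eq_neg_of_add_eq_zero_left (ExteriorAlgebra.ι_add_mul_swap v w)
  have h' : ∀ (v w : A x) (U : ExteriorAlgebra ℝ (A x)), ExteriorAlgebra.ι ℝ v *
      (ExteriorAlgebra.ι ℝ w * U) = -(ExteriorAlgebra.ι ℝ w * (ExteriorAlgebra.ι ℝ v * U)) :=
    fun v w U => by rw [← mul_assoc, h, neg_mul, mul_assoc]
  rw [schoutenTerm_sec, schoutenTerm_sec]
  simp only [List.length_cons, Fin.sum_univ_succ]
  simp only [Fin.val_zero, pow_zero, one_smul, List.get_cons_zero, List.eraseIdx_zero,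
    List.tail_cons, Fin.val_succ, List.get_cons_succ', List.eraseIdx_cons_succ, List.map_cons,
    wedge_cons, h' _ (Z x), pow_succ, mul_neg, mul_one, smul_neg, neg_smul, neg_neg, mul_add,
    smul_add, mul_smul_comm, Finset.mul_sum]
  abel

theorem schoutenTerm_sec_mul (Y : Sec E F A) (f g : Fn E M) (l : List (Sec E F A)) (x : M) :
    L.schoutenTerm (1, [Y]) (f * g, l) x =
      L.act Y f x • (g x • wedge (l.map fun Z => Z x)) +
        f x • L.schoutenTerm (1, [Y]) (g, l) x := by
  have h : L.act Y (f * g : Fn E M) x = f x * L.act Y g x + L.act Y f x * g x := L.act_mul Y f g x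
  have h1 : (f * g : Fn E M) x = f x * g x := rfl
  rw [schoutenTerm_sec, schoutenTerm_sec, h, h1]
  module

end LieAlgebroid

/-! ### Leibniz rules of a generating operator -/

namespace LieAlgebroid

variable {L : LieAlgebroid E F A} {D D' : MultiField E F A →ₗ[ℝ] MultiField E F A}

/-- Local expansions of U and V exist at every point, so the relation fixes the value there. -/
theorem IsSchoutenBracket.unique {U V W W' : MultiField E F A} (h : L.IsSchoutenBracket U V W)
    (h' : L.IsSchoutenBracket U V W') : W = W' :=
  MultiField.ext fun x => by
    obtain ⟨S, hS⟩ := exists_eventually_evalAt_eq U x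
    obtain ⟨T, hT⟩ := exists_eventually_evalAt_eq V x
    exact (h x S T hS hT).trans (h' x S T hS hT).symm

theorem IsGenerating.map_ofFn (hD : L.IsGenerating D) (f : Fn E M) : D (ofFn f) = 0 :=
  hD.degree_zero _ (ofFn_mem_grade f)

/-- Putting U = f in the generating identity gives this, since D f = 0 and [f, V] = -df ⌟ V: D is a
first-order operator with symbol -df ⌟. -/
theorem IsGenerating.evalAt_map_ofFn_mul (hD : L.IsGenerating D) (f : Fn E M)
    (V : MultiField E F A) (x : M) : evalAt x (D (ofFn f * V)) =
      f x • evalAt x (D V) - covectorContract (L.dFn f x) (evalAt x V) := by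
  obtain ⟨T, hT⟩ := exists_eventually_evalAt_eq V x
  have h := hD.generates 0 (ofFn f) (ofFn_mem_grade f) V x [(f, [])] T
    (Filter.Eventually.of_forall fun y => by
      show evalAt y (ofFn f : MultiField E F A) = _
      simp [evalTerms, Algebra.algebraMap_eq_smul_one]) hT
  rw [hD.map_ofFn, zero_mul, sub_zero, pow_zero, one_smul, one_smul] at h
  have h' : evalAt x (D (ofFn f * V) - ofFn f * D V) =
      -covectorContract (L.dFn f x) (evalAt x V) := by
    refine h.trans ?_
    rw [hT.self_of_nhds, evalTerms, map_list_sum, List.map_map]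
    simp only [List.map_cons, List.map_nil, List.sum_singleton, schoutenTerm_fn]
    rw [List.sum_neg, List.map_map]
    rfl
  rw [map_sub, evalAt_ofFn_mul, sub_eq_iff_eq_add] at h'
  rw [h', neg_add_eq_sub]

/-- The Lie derivative `[Y, V]` of a multivector field along a section, expressed through a
generating operator. -/
def lieDer (D : MultiField E F A →ₗ[ℝ] MultiField E F A) (Y : Sec E F A) (V : MultiField E F A) :
    MultiField E F A :=
  -(D (ofSec Y * V) - D (ofSec Y) * V + ofSec Y * D V)

theorem map_ofSec_mul (D : MultiField E F A →ₗ[ℝ] MultiField E F A) (Y : Sec E F A)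
    (V : MultiField E F A) :
    D (ofSec Y * V) = D (ofSec Y) * V - ofSec Y * D V - lieDer D Y V := by
  rw [lieDer]; abel

theorem IsGenerating.evalAt_lieDer (hD : L.IsGenerating D) (Y : Sec E F A) {V : MultiField E F A}
    {x : M} {T : List (Fn E M × List (Sec E F A))} (hT : ∀ᶠ y in 𝓝 x, evalAt y V = evalTerms T y) :
    evalAt x (lieDer D Y V) = (T.map fun t => L.schoutenTerm (1, [Y]) t x).sum := by
  have h := hD.generates 1 (ofSec Y) (ofSec_mem_grade Y) V x [(1, [Y])] T
    (Filter.Eventually.of_forall fun y => by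
      show evalAt y (ofSec Y) = _
      simp [evalTerms]) hT
  have h1 : lieDer D Y V =
      (-1 : ℝ) ^ 1 • (D (ofSec Y * V) - D (ofSec Y) * V - (-1 : ℝ) ^ 1 • (ofSec Y * D V)) := by
    rw [lieDer, pow_one, neg_one_smul, neg_one_smul, sub_neg_eq_add]
  rw [h1]
  refine h.trans ?_
  simp

theorem IsGenerating.evalAt_lieDer_ofSec_mul (hD : L.IsGenerating D) (Y Z : Sec E F A)
    (V : MultiField E F A) (x : M) : evalAt x (lieDer D Y (ofSec Z * V)) =
      ExteriorAlgebra.ι ℝ (L.bracket Y Z x) * evalAt x V +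
        ExteriorAlgebra.ι ℝ (Z x) * evalAt x (lieDer D Y V) := by
  obtain ⟨T, hT⟩ := exists_eventually_evalAt_eq V x
  have hT' : ∀ᶠ y in 𝓝 x, evalAt y (ofSec Z * V) =
      evalTerms (T.map fun t => (t.1, Z :: t.2)) y := by
    filter_upwards [hT] with y hy
    rw [map_mul, hy, evalAt_ofSec, evalTerms, evalTerms, ← List.sum_map_mul_left, List.map_map]
    congr 2
    funext t
    simp
  rw [hD.evalAt_lieDer Y hT', hD.evalAt_lieDer Y hT, hT.self_of_nhds, evalTerms,
    ← List.sum_map_mul_left, ← List.sum_map_mul_left, ← List.sum_map_add, List.map_map]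
  congr 2
  funext t
  exact L.schoutenTerm_sec_cons Y Z t.1 t.2 x

theorem IsGenerating.evalAt_lieDer_ofFn_mul (hD : L.IsGenerating D) (Y : Sec E F A) (f : Fn E M)
    (V : MultiField E F A) (x : M) : evalAt x (lieDer D Y (ofFn f * V)) =
      L.act Y f x • evalAt x V + f x • evalAt x (lieDer D Y V) := by
  obtain ⟨T, hT⟩ := exists_eventually_evalAt_eq V x
  have hT' : ∀ᶠ y in 𝓝 x, evalAt y (ofFn f * V) =
      evalTerms (T.map fun t => (f * t.1, t.2)) y := by
    filter_upwards [hT] with y hy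
    rw [evalAt_ofFn_mul, hy, evalTerms, evalTerms, List.smul_sum, List.map_map, List.map_map]
    congr 2
    funext t
    simp [mul_smul]
  rw [hD.evalAt_lieDer Y hT', hD.evalAt_lieDer Y hT, hT.self_of_nhds, evalTerms,
    List.smul_sum, List.smul_sum, List.map_map, List.map_map, List.map_map, ← List.sum_map_add]
  congr 2
  funext t
  exact L.schoutenTerm_sec_mul Y f t.1 t.2 x

theorem lieDer_sub (D : MultiField E F A →ₗ[ℝ] MultiField E F A) (Y : Sec E F A)
    (U V : MultiField E F A) : lieDer D Y (U - V) = lieDer D Y U - lieDer D Y V := by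
  simp only [lieDer, mul_sub, map_sub]
  abel

theorem IsGenerating.map_one (hD : L.IsGenerating D) : D 1 = 0 := by
  have h : (1 : MultiField E F A) = ofFn 1 := MultiField.ext fun x => by simp
  rw [h, hD.map_ofFn]

theorem IsGenerating.lieDer_one (hD : L.IsGenerating D) (Y : Sec E F A) :
    lieDer D Y (1 : MultiField E F A) = 0 := by
  rw [lieDer, hD.map_one]
  simp

theorem IsGenerating.exists_map_ofSec (hD : L.IsGenerating D) (X : Sec E F A) :
    ∃ g : Fn E M, D (ofSec X) = ofFn g :=
  exists_eq_ofFn (hD.degree 0 _ (ofSec_mem_grade X))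

/-! ### The difference of two generating operators -/

/-- Both generating identities compute the same bracket [U, V], so it drops out of their difference.
-/
theorem IsGenerating.sub_map_mul (hD : L.IsGenerating D) (hD' : L.IsGenerating D') {u : ℕ}
    {U : MultiField E F A} (hU : U ∈ MultiField.grade E F A u) (V : MultiField E F A) :
    (D - D') (U * V) = (D - D') U * V + (-1 : ℝ) ^ u • (U * (D - D') V) := by
  have h := (hD.generates u U hU V).unique (hD'.generates u U hU V)
  have h0 : ((-1 : ℝ) ^ u) ≠ 0 := pow_ne_zero _ (by norm_num)
  have h1 := smul_right_injective _ h0 h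
  simp only [LinearMap.sub_apply, sub_mul, mul_sub, smul_sub]
  have h2 := sub_eq_zero.2 h1
  rw [← sub_eq_zero, ← h2]
  abel

theorem ofSec_add (X Y : Sec E F A) : ofSec (X + Y) = ofSec X + ofSec Y :=
  MultiField.ext fun x => by simp

theorem ofSec_smul (c : ℝ) (X : Sec E F A) : ofSec (c • X) = c • ofSec X :=
  MultiField.ext fun x => by simp

theorem ofSec_fnSmul (f : Fn E M) (X : Sec E F A) : ofSec (fnSmul f X) = ofFn f * ofSec X :=
  MultiField.ext fun x => by rw [evalAt_ofFn_mul]; simp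

theorem IsGenerating.exists_form_sub_eq_contract (hD : L.IsGenerating D) (hD' : L.IsGenerating D') :
    ∃ α : Form E F A 1, ∀ U x,
      evalAt x ((D - D') U) = covectorContract (α.covector x) (evalAt x U) := by
  set δ := D - D'
  have hfn : ∀ (f : Fn E M) (V : MultiField E F A), δ (ofFn f * V) = ofFn f * δ V := by
    intro f V
    have h0 : δ (ofFn f) = 0 := by
      show D (ofFn f) - D' (ofFn f) = 0
      rw [hD.map_ofFn, hD'.map_ofFn, sub_zero]
    rw [hD.sub_map_mul hD' (ofFn_mem_grade f), h0, zero_mul, zero_add, pow_zero, one_smul]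
  have hex : ∀ X, ∃ g : Fn E M, δ (ofSec X) = ofFn g := fun X =>
    exists_eq_ofFn (Submodule.sub_mem _ (hD.degree 0 _ (ofSec_mem_grade X))
      (hD'.degree 0 _ (ofSec_mem_grade X)))
  choose g hg using hex
  -- The functions δX give α: they depend on X linearly over functions, hence on its value at x
  -- only.
  let T : (x : M) → Sec E F A →ₗ[ℝ] ℝ := fun x =>
    { toFun := fun X => ExteriorAlgebra.algebraMapInv (evalAt x (δ (ofSec X)))
      map_add' := fun X Y => by simp only [ofSec_add, map_add]
      map_smul' := fun c X => by simp only [ofSec_smul, map_smul, RingHom.id_apply] }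
  have hT : ∀ x X, T x X = g X x := fun x X => by
    show ExteriorAlgebra.algebraMapInv (evalAt x (δ (ofSec X))) = _
    rw [hg, evalAt_ofFn, ExteriorAlgebra.algebraMap_leftInverse]
  have hTf : ∀ x f X, T x (fnSmul f X) = f x • T x X := fun x f X => by
    show ExteriorAlgebra.algebraMapInv (evalAt x (δ (ofSec (fnSmul f X)))) = _
    rw [ofSec_fnSmul, hfn, evalAt_ofFn_mul, map_smul]
    rfl
  let α : Form E F A 1 :=
    ⟨fun x => AlternatingMap.ofSubsingleton ℝ (A x) ℝ (0 : Fin 1) (tensorialMap (T x) (hTf x)),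
      fun X => (g (X 0)).contMDiff.congr fun x => by
        show tensorialMap (T x) (hTf x) (X 0 x) = _
        rw [tensorialMap_apply, hT]⟩
  have hα : ∀ x X, α.covector x (X x) = g X x := fun x X => by
    show tensorialMap (T x) (hTf x) (X x) = _
    rw [tensorialMap_apply, hT]
  refine ⟨α, fun U x => evalAt_map_eq_of_forall_ofList δ (covectorContract (α.covector x))
    (fun f V => by rw [hfn, evalAt_ofFn_mul]) (fun l => ?_) U⟩
  induction l with
  | nil =>
    have h1 : δ (1 : MultiField E F A) = 0 := by
      show D 1 - D' 1 = 0
      rw [hD.map_one, hD'.map_one, sub_zero]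
    show evalAt x (δ 1) = covectorContract _ (evalAt x 1)
    rw [h1, map_zero, _root_.map_one, covectorContract_one]
  | cons X l ih =>
    rw [ofList_cons, hD.sub_map_mul hD' (ofSec_mem_grade X), map_add, map_smul, map_mul, map_mul,
      ih, hg, map_mul, evalAt_ofSec, covectorContract_ι_mul, hα, evalAt_ofFn,
      ← Algebra.smul_def, pow_one, neg_one_smul, sub_eq_add_neg]

/-! ### The anticommutator of a generating operator with a contraction -/

section Anticommutator

variable {i : MultiField E F A →ₗ[ℝ] MultiField E F A} {α : Form E F A 1}

theorem contraction_ofFn_mul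
    (hi : ∀ U x, evalAt x (i U) = covectorContract (α.covector x) (evalAt x U)) (f : Fn E M)
    (V : MultiField E F A) : i (ofFn f * V) = ofFn f * i V :=
  MultiField.ext fun x => by simp only [hi, evalAt_ofFn_mul, map_smul]

theorem contraction_ofSec_mul
    (hi : ∀ U x, evalAt x (i U) = covectorContract (α.covector x) (evalAt x U)) (Y : Sec E F A)
    (V : MultiField E F A) : i (ofSec Y * V) = ofFn (α.pair Y) * V - ofSec Y * i V :=
  MultiField.ext fun x => by
    rw [hi, map_mul (evalAt x), map_sub, evalAt_ofFn_mul, map_mul (evalAt x), evalAt_ofSec,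
      covectorContract_ι_mul, hi]
    rfl

/-- `L_Y i_α - i_α L_Y = i_{i_Y dα} + i_{d⟨α, Y⟩}` on decomposable multivector fields. -/
theorem IsGenerating.lieDer_contraction_ofList (hD : L.IsGenerating D)
    (hi : ∀ U x, evalAt x (i U) = covectorContract (α.covector x) (evalAt x U)) (Y : Sec E F A)
    (x : M) (l : List (Sec E F A)) :
    evalAt x (lieDer D Y (i (ofList l))) - evalAt x (i (lieDer D Y (ofList l))) =
      covectorContract (L.dBilin α x (Y x)) (evalAt x (ofList l)) +
        covectorContract (L.dFn (α.pair Y) x) (evalAt x (ofList l)) := by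
  induction l with
  | nil =>
    have h1 : i (ofList []) = 0 := MultiField.ext fun y => by
      show evalAt y (i 1) = _
      rw [hi, _root_.map_one, covectorContract_one, map_zero]
    have h2 : lieDer D Y (0 : MultiField E F A) = 0 := by simp [lieDer]
    have h3 : lieDer D Y (ofList []) = 0 := hD.lieDer_one Y
    have h4 : evalAt x (ofList ([] : List (Sec E F A))) = 1 := _root_.map_one _
    rw [h1, h2, h3, map_zero, map_zero, h4, covectorContract_one, covectorContract_one]
    simp
  | cons Z l ih =>
    rw [sub_eq_iff_eq_add] at ih
    -- On both sides the multivector without Z has the coefficient a(Y)⟨α, Z⟩ - ⟨α, [Y, Z]⟩: on the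
    -- right, the term a(Z)⟨α, Y⟩ of dα(Y, Z) cancels against d⟨α, Y⟩ evaluated on Z.
    rw [ofList_cons, contraction_ofSec_mul hi, lieDer_sub, map_sub, hD.evalAt_lieDer_ofFn_mul,
      hD.evalAt_lieDer_ofSec_mul, ih, hi (ofList l), hi (lieDer D Y (ofList l)),
      hi (lieDer D Y (ofSec Z * ofList l)), hD.evalAt_lieDer_ofSec_mul, map_add,
      covectorContract_ι_mul, covectorContract_ι_mul, map_mul, evalAt_ofSec,
      covectorContract_ι_mul, covectorContract_ι_mul, dBilin_apply, dOneForm_apply,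
      act_eq_dFn, act_eq_dFn, Form.pair_apply]
    simp only [mul_add]
    module

/-- For Y ∧ V the terms containing D Y cancel, as do those with ⟨α, Y⟩ D V. What is left is Y ∧ (D
i_α + i_α D)V plus (L_Y i_α - i_α L_Y)V minus d⟨α, Y⟩ ⌟ V. By the commutator formula the last two
amount to i_{i_Y dα} V, which is the recursion for i_{dα}. -/
theorem IsGenerating.anticommutator_ofList (hD : L.IsGenerating D)
    (hi : ∀ U x, evalAt x (i U) = covectorContract (α.covector x) (evalAt x U)) (x : M)
    (l : List (Sec E F A)) :
    evalAt x (D (i (ofList l)) + i (D (ofList l))) =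
      contractAt F x (L.d α x) (evalAt x (ofList l)) := by
  induction l with
  | nil =>
    have h1 : i (ofList []) = 0 := MultiField.ext fun y => by
      show evalAt y (i 1) = _
      rw [hi, _root_.map_one, covectorContract_one, map_zero]
    have h2 : D (ofList []) = 0 := hD.map_one
    have h4 : evalAt x (ofList ([] : List (Sec E F A))) = 1 := _root_.map_one _
    rw [h1, h2, map_zero, map_zero, add_zero, map_zero, h4, contract_d_one]
  | cons Y l ih =>
    obtain ⟨g, hg⟩ := hD.exists_map_ofSec Y
    have hL := hD.lieDer_contraction_ofList hi Y x l
    rw [ofList_cons, contraction_ofSec_mul hi, map_sub, map_ofSec_mul, map_ofSec_mul, map_sub,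
      map_sub, hg, contraction_ofFn_mul hi, contraction_ofSec_mul hi, map_mul (evalAt x) (ofSec Y),
      evalAt_ofSec, contract_dAlternating_ι_mul, ← ih]
    simp only [map_add, map_sub, hD.evalAt_map_ofFn_mul, evalAt_ofFn_mul,
      map_mul (evalAt x) (ofSec Y),
      evalAt_ofSec, mul_add]
    rw [sub_eq_iff_eq_add] at hL
    rw [hL]
    module

theorem IsGenerating.anticommutator_contraction (hD : L.IsGenerating D)
    (hi : ∀ U x, evalAt x (i U) = covectorContract (α.covector x) (evalAt x U))
    (U : MultiField E F A) (x : M) :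
    evalAt x (D (i U) + i (D U)) = contractAt F x (L.d α x) (evalAt x U) := by
  have : FiniteDimensional ℝ (A x) := VectorBundle.finiteDimensional ℝ F A x
  refine evalAt_map_eq_of_forall_ofList (D ∘ₗ i + i ∘ₗ D)
    { toFun := contractAt F x (L.d α x)
      map_add' := contract_add_right _
      map_smul' := contract_smul_right _ } (fun f V => ?_)
    (fun l => hD.anticommutator_ofList hi x l) U
  -- The anticommutator is linear over functions: D contributes -df ⌟ in both orders, and the
  -- contractions with df and α anticommute.
  simp only [LinearMap.add_apply, LinearMap.comp_apply, contraction_ofFn_mul hi, map_add,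
    hD.evalAt_map_ofFn_mul]
  rw [hi (D (ofFn f * V)), hD.evalAt_map_ofFn_mul, hi, hi, map_sub, map_smul,
    covectorContract_comm (L.dFn f x)]
  module

end Anticommutator

/-- Squares of two generating operators that differ by the contraction with `α`. -/
theorem IsGenerating.sq_sub_sq (hD : L.IsGenerating D) {α : Form E F A 1}
    (hα : ∀ U x, evalAt x (D U) - evalAt x (D' U) = covectorContract (α.covector x) (evalAt x U))
    (U : MultiField E F A) (x : M) :
    evalAt x (D' (D' U)) - evalAt x (D (D U)) = -contractAt F x (L.d α x) (evalAt x U) := by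
  have hi : ∀ U x, evalAt x ((D - D') U) = covectorContract (α.covector x) (evalAt x U) :=
    fun U x => by rw [LinearMap.sub_apply, map_sub, hα]
  -- Expanding i_α² = 0 gives D² + D'² = DD' + D'D, which turns the anticommutator of D with D - D'
  -- into D² - D'².
  have h0 : (D - D') ((D - D') U) = 0 := MultiField.ext fun y => by
    rw [hi, hi, map_zero]
    exact CliffordAlgebra.contractLeft_contractLeft ..
  rw [← hD.anticommutator_contraction hi]
  have h1 := congrArg (evalAt x) h0
  simp only [LinearMap.sub_apply, map_sub, map_add, map_zero] at h1 ⊢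
  rw [← sub_eq_zero, ← h1]
  abel

end LieAlgebroid

/-! ### Homogeneous components -/

/-- Projection merely selects the terms with k factors, so homogeneous components stay smooth. -/
theorem proj_evalTerms (k : ℕ) (S : List (Fn E M × List (Sec E F A))) (x : M) :
    GradedRing.proj (fun i => ⋀[ℝ]^i (A x)) k (evalTerms S x) =
      evalTerms (S.filter fun t => t.2.length = k) x := by
  induction S with
  | nil => simp [evalTerms]
  | cons t S ih =>
    have h1 : evalTerms (t :: S) x = t.1 x • wedge (t.2.map fun X => X x) + evalTerms S x := by
      simp [evalTerms]
    have hm : t.1 x • wedge (t.2.map fun X => X x) ∈ ⋀[ℝ]^t.2.length (A x) := by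
      have := wedge_mem (t.2.map fun X => X x)
      rw [List.length_map] at this
      exact Submodule.smul_mem _ _ this
    rw [h1, map_add, ih, GradedRing.proj_apply]
    by_cases ht : t.2.length = k
    · rw [List.filter_cons_of_pos (by simpa using ht), ← ht,
        DirectSum.decompose_of_mem_same (fun i => ⋀[ℝ]^i (A x)) hm]
      simp [evalTerms]
    · rw [List.filter_cons_of_neg (by simpa using ht), 
        DirectSum.decompose_of_mem_ne (fun i => ⋀[ℝ]^i (A x)) hm ht, zero_add]

/-- The homogeneous component of degree `k` of a multivector field. -/
def component (k : ℕ) (U : MultiField E F A) : MultiField E F A :=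
  ⟨fun x => GradedRing.proj (fun i => ⋀[ℝ]^i (A x)) k (evalAt x U), fun x => by
    obtain ⟨S, hS⟩ := exists_eventually_evalAt_eq U x
    refine ⟨S.filter fun t => t.2.length = k, ?_⟩
    filter_upwards [hS] with y hy
    rw [hy, proj_evalTerms]⟩

theorem component_mem_grade (k : ℕ) (U : MultiField E F A) :
    component k U ∈ MultiField.grade E F A k := fun x =>
  (DirectSum.decompose (fun i => ⋀[ℝ]^i (A x)) (evalAt x U) k).2

theorem finrank_fibre (F : Type*) [NormedAddCommGroup F] [NormedSpace ℝ F] [FiniteDimensional ℝ F]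
    {A : M → Type*} [TopologicalSpace (Bundle.TotalSpace F A)] [∀ x, TopologicalSpace (A x)]
    [∀ x, AddCommGroup (A x)] [∀ x, Module ℝ (A x)] [FiberBundle F A] [VectorBundle ℝ F A] (x : M) :
    Module.finrank ℝ (A x) = Module.finrank ℝ F :=
  (VectorBundle.continuousLinearEquivAt ℝ F A x).toLinearEquiv.finrank_eq

/-- Exterior powers above the rank vanish, so one finite range serves all points. `IsOperator`
speaks of homogeneous fields only; this decomposition extends comparisons to all of 𝒜. -/
theorem sum_component (U : MultiField E F A) :
    ∑ k ∈ Finset.range (Module.finrank ℝ F + 1), component k U = U :=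
  MultiField.ext fun x => by
    classical
    have : FiniteDimensional ℝ (A x) := VectorBundle.finiteDimensional ℝ F A x
    rw [map_sum]
    conv_rhs => rw [← DirectSum.sum_support_decompose (fun i => ⋀[ℝ]^i (A x)) (evalAt x U)]
    refine (Finset.sum_subset (fun k hk => ?_) fun k _ hk => ?_).symm
    · rw [Finset.mem_range]
      by_contra hlt
      have hbot := exteriorPower_eq_bot_of_finrank_lt (V := A x) (k := k)
        (by rw [finrank_fibre F x]; omega)
      have hmem := (DirectSum.decompose (fun i => ⋀[ℝ]^i (A x)) (evalAt x U) k).2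
      rw [DFinsupp.mem_support_iff] at hk
      refine hk (Subtype.ext ?_)
      have : ∀ W ∈ ⋀[ℝ]^k (A x), W = 0 := fun W hW => by rwa [hbot, Submodule.mem_bot] at hW
      exact this _ hmem
    · rw [DFinsupp.notMem_support_iff] at hk
      show ((DirectSum.decompose (fun i => ⋀[ℝ]^i (A x)) (evalAt x U) k : ⋀[ℝ]^k (A x)) :
        ExteriorAlgebra ℝ (A x)) = 0
      rw [hk]; rfl

/-! ### Contractions in the fibres -/

theorem contractAt_covectorWedge {p : ℕ} (x : M) (ξ : Module.Dual ℝ (A x))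
    (θ : (Fin p → A x) → ℝ) (U : ExteriorAlgebra ℝ (A x)) :
    contractAt F x (covectorWedge ξ θ) U = (-1 : ℝ) ^ p • covectorContract ξ (contractAt F x θ U) :=
  have : FiniteDimensional ℝ (A x) := VectorBundle.finiteDimensional ℝ F A x
  contract_covectorWedge ξ θ U

theorem contractAt_add {p : ℕ} (x : M) (θ θ' : (Fin p → A x) → ℝ) (U : ExteriorAlgebra ℝ (A x)) :
    contractAt F x (fun v => θ v + θ' v) U = contractAt F x θ U + contractAt F x θ' U :=
  have : FiniteDimensional ℝ (A x) := VectorBundle.finiteDimensional ℝ F A x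
  contract_add θ θ' U

theorem contractAt_smul {p : ℕ} (x : M) (c : ℝ) (θ : (Fin p → A x) → ℝ)
    (U : ExteriorAlgebra ℝ (A x)) :
    contractAt F x (fun v => c * θ v) U = c • contractAt F x θ U :=
  have : FiniteDimensional ℝ (A x) := VectorBundle.finiteDimensional ℝ F A x
  contract_smul c θ U

theorem contractAt_add_right {p : ℕ} (x : M) (θ : (Fin p → A x) → ℝ)
    (U W : ExteriorAlgebra ℝ (A x)) :
    contractAt F x θ (U + W) = contractAt F x θ U + contractAt F x θ W :=
  have : FiniteDimensional ℝ (A x) := VectorBundle.finiteDimensional ℝ F A x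
  contract_add_right θ U W

theorem contractAt_smul_right {p : ℕ} (x : M) (c : ℝ) (θ : (Fin p → A x) → ℝ)
    (U : ExteriorAlgebra ℝ (A x)) :
    contractAt F x θ (c • U) = c • contractAt F x θ U :=
  have : FiniteDimensional ℝ (A x) := VectorBundle.finiteDimensional ℝ F A x
  contract_smul_right θ c U

theorem contractAt_zero_right {p : ℕ} (x : M) (θ : (Fin p → A x) → ℝ) :
    contractAt F x θ (0 : ExteriorAlgebra ℝ (A x)) = 0 :=
  have : FiniteDimensional ℝ (A x) := VectorBundle.finiteDimensional ℝ F A x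
  contract_zero_right θ

/-- A form is determined by its contraction with a nonzero multivector of top degree. -/
theorem contractAt_injective {p : ℕ} {x : M} {Λ : ExteriorAlgebra ℝ (A x)}
    (hΛ : Λ ∈ ⋀[ℝ]^(Module.finrank ℝ F) (A x)) (h0 : Λ ≠ 0) (θ θ' : (A x) [⋀^Fin p]→ₗ[ℝ] ℝ)
    (h : contractAt F x θ Λ = contractAt F x θ' Λ) : θ = θ' := by
  have : FiniteDimensional ℝ (A x) := VectorBundle.finiteDimensional ℝ F A x
  rw [← finrank_fibre F (A := A) x] at hΛ
  rw [← sub_eq_zero]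
  refine eq_zero_of_contract_top_eq_zero hΛ h0 _ ?_
  have h1 : ⇑(θ - θ') = fun v => θ v + (-1) * θ' v := by
    funext v
    rw [AlternatingMap.sub_apply]
    ring
  have h2 : contractAt F x ⇑(θ - θ') Λ = 0 := by
    rw [h1, contractAt_add, contractAt_smul, h, neg_one_smul, add_neg_cancel]
  exact h2

/-- `∑ᵢ ξ(bᵢ) (bⁱ ∧ θ) ⌟ U = (ξ ∧ θ) ⌟ U`. -/
theorem sum_smul_contractAt_covectorWedge {p : ℕ} {x : M} {ι : Type*} [Fintype ι]
    (b : Module.Basis ι ℝ (A x)) (c : ι → ℝ) (θ : (Fin p → A x) → ℝ)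
    (U : ExteriorAlgebra ℝ (A x)) :
    ∑ i, contractAt F x (covectorWedge (b.coord i) θ) (c i • U) =
      (-1 : ℝ) ^ p • covectorContract (∑ i, c i • b.coord i) (contractAt F x θ U) := by
  rw [covectorContract_sum_smul, Finset.smul_sum]
  refine Finset.sum_congr rfl fun i _ => ?_
  rw [contractAt_smul_right, contractAt_covectorWedge, smul_comm]

/-! ### The differential of forms -/

theorem Form.covector_smul_neg_one (α : Form E F A 1) (x : M) :
    (α.smul (-1)).covector x = -α.covector x := by
  ext v
  exact neg_one_mul _

/-- The product of a smooth function and a form. -/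
def Form.fnMul {p : ℕ} (g : Fn E M) (θ : Form E F A p) : Form E F A p :=
  ⟨fun x => g x • θ.toFun x, fun X => g.contMDiff.mul (θ.smooth X)⟩

namespace LieAlgebroid

variable (L : LieAlgebroid E F A)

/-- `d(g θ) = g dθ + dg ∧ θ`. -/
theorem d_fnMul {p : ℕ} (g : Fn E M) (θ : Form E F A p) (x : M) :
    L.d (θ.fnMul g) x = fun v => g x * L.d θ x v + covectorWedge (L.dFn g x) (θ.toFun x) v := by
  funext v
  have hb : ∀ X, L.dBracketPart (θ.fnMul g) X x = g x * L.dBracketPart θ X x := by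
    intro X
    cases p with
    | zero => simp [dBracketPart]
    | succ q =>
      simp only [dBracketPart, Finset.mul_sum]
      refine Finset.sum_congr rfl fun j _ => Finset.sum_congr rfl fun i _ => ?_
      split_ifs
      · exact mul_left_comm _ _ _
      · simp
  simp only [d, dOnSections, hb, covectorWedge]
  rw [mul_add, add_right_comm, Finset.mul_sum, ← Finset.sum_add_distrib]
  congr 1
  refine Finset.sum_congr rfl fun i _ => ?_
  have h := dirDeriv_mul g.contMDiff (θ.smooth fun l => i.removeNth
    (fun j => sectionThrough E F (v j)) l) x (L.anchor x (sectionThrough E F (v i) x))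
  have h1 : (fun l => i.removeNth (fun j => sectionThrough E F (v j)) l x) = i.removeNth v := by
    funext l
    simp [Fin.removeNth]
  rw [h1, ← dFn_apply, ← dFn_apply, ← dFn_apply, sectionThrough_apply] at h
  rw [act_eq_dFn, act_eq_dFn, sectionThrough_apply]
  refine (congrArg _ h).trans ?_
  ring

/-- Locality of d is needed because a form representing U = θ ⌟ Λ is determined only near the point.
-/
theorem d_congr {p : ℕ} {θ θ' : Form E F A p} {x : M}
    (h : ∀ᶠ y in 𝓝 x, θ.toFun y = θ'.toFun y) : L.d θ x = L.d θ' x := by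
  funext v
  have hb : ∀ X, L.dBracketPart θ X x = L.dBracketPart θ' X x := by
    intro X
    cases p with
    | zero => simp [dBracketPart]
    | succ q => simp only [dBracketPart, h.self_of_nhds]
  simp only [d, dOnSections, hb]
  congr 1
  refine Finset.sum_congr rfl fun i _ => ?_
  congr 1
  refine dirDeriv_congr ?_ _
  filter_upwards [h] with y hy
  rw [hy]

theorem dFn_neg (f : Fn E M) (x : M) : L.dFn (-f : Fn E M) x = -L.dFn f x := by
  ext v
  have h := dirDeriv_smul (-1) f.contMDiff x (L.anchor x v)
  have h1 : (fun y => -1 * f y) = (-f : Fn E M) := by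
    funext y
    simp
  rw [h1] at h
  rw [LinearMap.neg_apply, dFn_apply, dFn_apply, h, neg_one_mul]

theorem isExactForm_iff (α : Form E F A 1) :
    L.IsExactForm α ↔ ∃ f : Fn E M, ∀ x, α.covector x = L.dFn f x := by
  refine exists_congr fun f => forall_congr' fun x => ⟨fun h => ?_, fun h v => ?_⟩
  · ext v
    exact h fun _ => v
  · rw [Form.toFun_eq_covector, h]; rfl

theorem IsExactForm.neg {α : Form E F A 1} (h : L.IsExactForm α) : L.IsExactForm (α.smul (-1)) := by
  obtain ⟨f, hf⟩ := (L.isExactForm_iff α).1 h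
  refine (L.isExactForm_iff _).2 ⟨-f, fun x => ?_⟩
  rw [dFn_neg, ← hf]
  ext v
  exact neg_one_mul _

end LieAlgebroid

/-- The exponential of a smooth function. -/
def expFn (f : Fn E M) : Fn E M :=
  ⟨fun x => Real.exp (f x), Real.contDiff_exp.comp_contMDiff f.contMDiff⟩

theorem expFn_apply (f : Fn E M) (x : M) : expFn f x = Real.exp (f x) := rfl

/-- Multiplication of multivector fields with `exp f`. -/
def expMul (f : Fn E M) : MultiField E F A ≃ₗ[ℝ] MultiField E F A where
  toFun U := ofFn (expFn f) * U
  map_add' U W := mul_add _ _ _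
  map_smul' c U := mul_smul_comm _ _ _
  invFun U := ofFn (expFn (-f)) * U
  left_inv U := MultiField.ext fun x => by
    rw [evalAt_ofFn_mul, evalAt_ofFn_mul, smul_smul, expFn_apply, expFn_apply, ← Real.exp_add]
    simp
  right_inv U := MultiField.ext fun x => by
    rw [evalAt_ofFn_mul, evalAt_ofFn_mul, smul_smul, expFn_apply, expFn_apply, ← Real.exp_add]
    simp

theorem evalAt_expMul (f : Fn E M) (U : MultiField E F A) (x : M) :
    evalAt x (expMul f U) = Real.exp (f x) • evalAt x U := evalAt_ofFn_mul ..

theorem expMul_mem_grade (f : Fn E M) {k : ℕ} {U : MultiField E F A}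
    (hU : U ∈ MultiField.grade E F A k) : expMul f U ∈ MultiField.grade E F A k :=
  mem_grade_iff.2 fun x => by
    rw [evalAt_expMul]
    exact Submodule.smul_mem _ _ (hU x)

namespace LieAlgebroid.TopConnection

variable {L : LieAlgebroid E F A} {C C₁ C₂ : L.TopConnection}

theorem homotopic_iff : C₁.Homotopic C₂ ↔ ∃ α : Form E F A 1, L.IsExactForm α ∧ ∀ X s (x : M),
    evalAt x (C₁.nabla X s).1 = evalAt x (C₂.nabla X s).1 + α.covector x (X x) • evalAt x s.1 :=
  Iff.rfl

/-! ### Homology of homotopic connections -/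

/-- If θ represents U, then e^f θ represents e^f U. The extra term df ∧ θ in e^{-f} d(e^f θ) equals
the sum of the αᵢ ∧ θ weighted by ⟨df, Xᵢ⟩, which is what ∇₁ adds to ∇₂. -/
theorem IsD.expMul {f : Fn E M}
    (h : ∀ X s x, evalAt x (C₁.nabla X s).1 =
      evalAt x (C₂.nabla X s).1 + L.dFn f x (X x) • evalAt x s.1) {k : ℕ}
    {U W : MultiField E F A} (hD : C₁.IsD k U W) : C₂.IsD k (expMul f U) (expMul f W) := by
  intro x Λ hΛ X b hb
  obtain ⟨θ, hθ, hW⟩ := hD x Λ hΛ X b hb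
  refine ⟨θ.fnMul (expFn f), ?_, ?_⟩
  · filter_upwards [hθ] with y hy
    show AlgebroidHomology.evalAt y (AlgebroidHomology.expMul f U) = _
    rw [evalAt_expMul]
    refine (congrArg _ hy).trans (contractAt_smul y _ _ _).symm
  · show AlgebroidHomology.evalAt x (AlgebroidHomology.expMul f W) = _
    have hW' : evalAt x W = _ := hW
    have h1 : ∀ i, ((C₁.nabla (X i) Λ).1.1 x) =
        (C₂.nabla (X i) Λ).1.1 x + L.dFn f x (b i) • Λ.1.1 x := fun i => by
      rw [hb]; exact h (X i) Λ x
    have h2 : L.dFn (expFn f) x = Real.exp (f x) • L.dFn f x := by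
      ext v
      exact dirDeriv_exp f.contMDiff x _
    have h3 : ∀ i, contractAt F x (covectorWedge (b.coord i) ((θ.fnMul (expFn f)).toFun x))
        ((C₂.nabla (X i) Λ).1.1 x) = Real.exp (f x) •
          contractAt F x (covectorWedge (b.coord i) (θ.toFun x)) ((C₂.nabla (X i) Λ).1.1 x) := by
      intro i
      have hθ' : ⇑((θ.fnMul (expFn f)).toFun x) = fun v => Real.exp (f x) * θ.toFun x v := rfl
      rw [hθ', contractAt_covectorWedge, contractAt_smul, contractAt_covectorWedge, map_smul,
        smul_comm]
    have h4 : contractAt F x (fun v => covectorWedge (L.dFn (expFn f) x) (θ.toFun x) v)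
        (Λ.1.1 x) = Real.exp (f x) • ((-1 : ℝ) ^ (Module.finrank ℝ F - k) •
          covectorContract (L.dFn f x) (contractAt F x (θ.toFun x) (Λ.1.1 x))) := by
      refine (contractAt_covectorWedge x _ _ _).trans ?_
      rw [h2, smul_comm]
      simp only [covectorContract, map_smul, LinearMap.smul_apply]
    rw [evalAt_expMul, hW']
    simp only [h1, h3, contractAt_add_right, Finset.sum_add_distrib, L.d_fnMul]
    rw [contractAt_add, contractAt_smul, h4, sum_smul_contractAt_covectorWedge,
      basis_sum_coord_smul, ← Finset.smul_sum, expFn_apply]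
    module

/-- Multiplication with `exp f` identifies the cycles. -/
theorem map_expMul_cycles {f : Fn E M}
    (h : ∀ X s x, evalAt x (C₁.nabla X s).1 =
      evalAt x (C₂.nabla X s).1 + L.dFn f x (X x) • evalAt x s.1) {k : ℕ} {U : MultiField E F A}
    (hU : U ∈ C₁.cycles k) : expMul f U ∈ C₂.cycles k := by
  refine ⟨expMul_mem_grade f hU.1, ?_⟩
  have := IsD.expMul h hU.2
  rwa [smul_zero, map_zero, ← smul_zero ((-1 : ℝ) ^ (Module.finrank ℝ F - k))] at this

theorem map_expMul_boundaries {f : Fn E M}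
    (h : ∀ X s x, evalAt x (C₁.nabla X s).1 =
      evalAt x (C₂.nabla X s).1 + L.dFn f x (X x) • evalAt x s.1) {k : ℕ} {U : MultiField E F A}
    (hU : U ∈ C₁.boundaries k) : expMul f U ∈ C₂.boundaries k := by
  obtain ⟨hU, V, hV, hVU⟩ := hU
  refine ⟨expMul_mem_grade f hU, expMul f V, expMul_mem_grade f hV, ?_⟩
  have := IsD.expMul h hVU
  rwa [map_smul] at this

theorem Homotopic.nonempty_homology_equiv (h : C₁.Homotopic C₂) (k : ℕ) :
    Nonempty (C₁.Homology k ≃ₗ[ℝ] C₂.Homology k) := by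
  obtain ⟨α, hα, hC⟩ := homotopic_iff.1 h
  obtain ⟨f, hf⟩ := (L.isExactForm_iff α).1 hα
  simp only [hf] at hC
  have hC' : ∀ X s x, evalAt x (C₂.nabla X s).1 =
      evalAt x (C₁.nabla X s).1 + L.dFn (-f : Fn E M) x (X x) • evalAt x s.1 := by
    intro X s x
    rw [hC, L.dFn_neg, LinearMap.neg_apply, neg_smul, add_neg_cancel_right]
  have hsymm : ∀ U : MultiField E F A, expMul f (expMul (-f) U) = U := fun U =>
    (expMul f).apply_symm_apply U
  have hz : (C₁.cycles k).map (expMul f).toLinearMap = C₂.cycles k := by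
    ext U
    -- Surjectivity comes from the same statement with the connections exchanged and f replaced by
    -- -f.
    refine ⟨?_, fun hU => ⟨expMul (-f) U, map_expMul_cycles hC' hU, hsymm U⟩⟩
    rintro ⟨V, hV, rfl⟩
    exact map_expMul_cycles hC hV
  refine ⟨Submodule.Quotient.equiv _ _ ((expMul f).ofSubmodules _ _ hz) ?_⟩
  ext U
  refine ⟨?_, fun hU => ⟨⟨expMul (-f) U.1, map_expMul_cycles hC' U.2⟩,
    map_expMul_boundaries hC' hU, Subtype.ext (hsymm U.1)⟩⟩
  rintro ⟨V, hV, rfl⟩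
  exact map_expMul_boundaries hC hV

/-! ### Comparison of the operators of two connections -/

variable {D D₁ D₂ : MultiField E F A →ₗ[ℝ] MultiField E F A}

theorem exists_top_ne_zero (x : M) :
    ∃ Λ : MultiField.grade E F A (Module.finrank ℝ F), evalAt x Λ.1 ≠ 0 := by
  have : FiniteDimensional ℝ (A x) := VectorBundle.finiteDimensional ℝ F A x
  set b := Module.finBasisOfFinrankEq ℝ (A x) (finrank_fibre F x)
  have hm := ofList_mem_grade (List.ofFn fun i => sectionThrough E F (b i))
  rw [List.length_ofFn] at hm
  refine ⟨⟨_, hm⟩, ?_⟩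
  have h := wedge_basis_ne_zero b
  have h1 : (List.ofFn fun i => sectionThrough E F (b i)).map (fun X => X x) = List.ofFn b := by
    rw [List.map_ofFn]
    congr 1
    funext i
    simp
  rwa [← h1, ← evalAt_ofList] at h

/-- The constant field 1 is of the form θ ⌟ Λ near x, by the defining relation in degree 0; so Λ
cannot vanish there. -/
theorem IsOperator.eventually_ne_zero (hD : C.IsOperator D) {x : M}
    {Λ : MultiField.grade E F A (Module.finrank ℝ F)} (hΛ : evalAt x Λ.1 ≠ 0) :
    ∀ᶠ y in 𝓝 x, evalAt y Λ.1 ≠ 0 := by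
  have : FiniteDimensional ℝ (A x) := VectorBundle.finiteDimensional ℝ F A x
  set b := Module.finBasisOfFinrankEq ℝ (A x) (finrank_fibre F x)
  obtain ⟨θ, hθ, -⟩ := hD 0 (ofFn 1) (ofFn_mem_grade 1) x Λ hΛ
    (fun i => sectionThrough E F (b i)) b (fun i => by simp)
  filter_upwards [hθ] with y hy h0
  have h1 : (1 : ExteriorAlgebra ℝ (A y)) = contractAt F y (θ.toFun y) (Λ.1.1 y) := by
    rw [← hy]
    exact (_root_.map_one (algebraMap ℝ (ExteriorAlgebra ℝ (A y)))).symm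
  have h2 : Λ.1.1 y = 0 := h0
  rw [h2, contractAt_zero_right] at h1
  exact one_ne_zero h1

/-- Uniqueness makes the two representing forms agree near x, so their differentials at x cancel. In
the remaining connection terms, moving a covector past θ produces (-1)^{n-k}, which cancels the
prefactor and leaves the minus sign. -/
theorem IsOperator.sub_eq_contract (h₁ : C₁.IsOperator D₁) (h₂ : C₂.IsOperator D₂) {x : M}
    {Λ : MultiField.grade E F A (Module.finrank ℝ F)} (hΛ : evalAt x Λ.1 ≠ 0)
    {X : Fin (Module.finrank ℝ F) → Sec E F A}
    {b : Module.Basis (Fin (Module.finrank ℝ F)) ℝ (A x)} (hb : ∀ i, b i = X i x)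
    {c : Fin (Module.finrank ℝ F) → ℝ}
    (hc : ∀ i, evalAt x (C₁.nabla (X i) Λ).1 =
      evalAt x (C₂.nabla (X i) Λ).1 + c i • evalAt x Λ.1)
    {k : ℕ} {U : MultiField E F A} (hU : U ∈ MultiField.grade E F A k) :
    evalAt x (D₁ U) - evalAt x (D₂ U) =
      -covectorContract (∑ i, c i • b.coord i) (evalAt x U) := by
  obtain ⟨θ, hθ, hW⟩ := h₁ k U hU x Λ hΛ X b hb
  obtain ⟨θ', hθ', hW'⟩ := h₂ k U hU x Λ hΛ X b hb
  have hθθ' : ∀ᶠ y in 𝓝 x, θ.toFun y = θ'.toFun y := by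
    filter_upwards [hθ, hθ', h₁.eventually_ne_zero hΛ] with y h1 h2 h3
    exact contractAt_injective (Λ.2 y) h3 _ _ (h1.symm.trans h2)
  rw [← L.d_congr hθθ', ← hθθ'.self_of_nhds] at hW'
  have hW₁ : evalAt x (D₁ U) = _ := hW
  have hW₂ : evalAt x (D₂ U) = _ := hW'
  have hc' : ∀ i, (C₁.nabla (X i) Λ).1.1 x = (C₂.nabla (X i) Λ).1.1 x + c i • Λ.1.1 x := hc
  have hUx : evalAt x U = contractAt F x (θ.toFun x) (Λ.1.1 x) := hθ.self_of_nhds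
  have hsq : ((-1 : ℝ) ^ (Module.finrank ℝ F - k)) * (-1) ^ (Module.finrank ℝ F - k) = 1 := by
    rw [← mul_pow]; simp
  rw [hW₁, hW₂, hUx]
  simp only [hc', contractAt_add_right, Finset.sum_add_distrib, sum_smul_contractAt_covectorWedge]
  rw [← smul_sub]
  simp only [add_sub_add_left_eq_sub, add_sub_cancel_left]
  rw [neg_smul, smul_smul, hsq, one_smul]

theorem Homotopic.homotopicOperators (h : C₁.Homotopic C₂) (h₁ : C₁.IsOperator D₁)
    (h₂ : C₂.IsOperator D₂) : L.HomotopicOperators D₁ D₂ := by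
  obtain ⟨α, hα, hC⟩ := homotopic_iff.1 h
  -- The operators differ by -i_α, so the potential changes sign.
  refine ⟨α.smul (-1), hα.neg, fun U x => ?_⟩
  rw [contractAt_one, Form.covector_smul_neg_one]
  have : FiniteDimensional ℝ (A x) := VectorBundle.finiteDimensional ℝ F A x
  set b := Module.finBasisOfFinrankEq ℝ (A x) (finrank_fibre F x)
  obtain ⟨Λ, hΛ⟩ := exists_top_ne_zero (E := E) (F := F) (A := A) x
  have key : ∀ k, ∀ V ∈ MultiField.grade E F A k,
      evalAt x (D₁ V) - evalAt x (D₂ V) = -covectorContract (α.covector x) (evalAt x V) := by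
    intro k V hV
    rw [h₁.sub_eq_contract h₂ hΛ (X := fun i => sectionThrough E F (b i)) (b := b)
      (c := fun i => α.covector x (b i)) (fun i => by simp)
      (fun i => by simpa using hC (sectionThrough E F (b i)) Λ x) hV, basis_sum_coord_smul]
  show evalAt x (D₁ U) - evalAt x (D₂ U) = covectorContract (-α.covector x) (evalAt x U)
  conv_lhs => rw [← sum_component U]
  conv_rhs => rw [← sum_component U]
  simp only [map_sum, ← Finset.sum_sub_distrib]
  refine Finset.sum_congr rfl fun k _ => ?_
  rw [key k _ (component_mem_grade k U)]
  simp only [covectorContract, map_neg, LinearMap.neg_apply]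

theorem homotopic_of_homotopicOperators (h₁ : C₁.IsOperator D₁) (h₂ : C₂.IsOperator D₂)
    (h : L.HomotopicOperators D₁ D₂) : C₁.Homotopic C₂ := by
  obtain ⟨α, hα, hD⟩ := h
  have hD' : ∀ U x, evalAt x (D₁ U) - evalAt x (D₂ U) =
      covectorContract (α.covector x) (evalAt x U) := fun U x => by
    rw [← contractAt_one]
    exact hD U x
  have key : ∀ (x : M) (X : Sec E F A) (s : MultiField.grade E F A (Module.finrank ℝ F)),
      evalAt x s.1 ≠ 0 → evalAt x (C₁.nabla X s).1 - evalAt x (C₂.nabla X s).1 +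
        α.covector x (X x) • evalAt x s.1 = 0 := by
    intro x X s hs
    have : FiniteDimensional ℝ (A x) := VectorBundle.finiteDimensional ℝ F A x
    set b := Module.finBasisOfFinrankEq ℝ (A x) (finrank_fibre F x)
    -- The quantity that should vanish is tensorial in X, so checking a basis of the fibre is
    -- enough.
    let T : Sec E F A →ₗ[ℝ] ExteriorAlgebra ℝ (A x) :=
      { toFun := fun X => evalAt x (C₁.nabla X s).1 - evalAt x (C₂.nabla X s).1 +
          α.covector x (X x) • evalAt x s.1
        map_add' := fun X Y => by
          simp only [map_add, LinearMap.add_apply, Submodule.coe_add, ContMDiffSection.coe_add,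
            Pi.add_apply]
          module
        map_smul' := fun c X => by
          simp only [map_smul, LinearMap.smul_apply, Submodule.coe_smul, ContMDiffSection.coe_smul,
            Pi.smul_apply, RingHom.id_apply, smul_eq_mul]
          module }
    have hT : ∀ f X, T (fnSmul f X) = f x • T X := by
      intro f X
      have h : ∀ C : L.TopConnection, evalAt x (C.nabla (fnSmul f X) s).1 =
          f x • evalAt x (C.nabla X s).1 := fun C => by rw [C.smul_left]; rfl
      show evalAt x (C₁.nabla (fnSmul f X) s).1 - evalAt x (C₂.nabla (fnSmul f X) s).1 +
        α.covector x (fnSmul f X x) • evalAt x s.1 = f x • (_ - _ + _)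
      rw [h, h, fnSmul_apply, map_smul]
      module
    -- The top exterior power is a line spanned by the value of s, so the difference of the
    -- connections is a multiple of it.
    have hc : ∀ i, ∃ c : ℝ, c • evalAt x s.1 =
        evalAt x (C₁.nabla (sectionThrough E F (b i)) s).1 -
          evalAt x (C₂.nabla (sectionThrough E F (b i)) s).1 := fun i => by
      have hm : ∀ u : MultiField.grade E F A (Module.finrank ℝ F),
          evalAt x u.1 ∈ ⋀[ℝ]^(Module.finrank ℝ (A x)) (A x) := fun u => by
        rw [finrank_fibre F x]; exact u.2 x
      exact exists_smul_eq_of_mem_top (hm s) hs (Submodule.sub_mem _ (hm _) (hm _))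
    choose c hc using hc
    -- On a section through the basis vector bⱼ both expressions for D₁ - D₂ are scalars, namely ⟨α,
    -- bⱼ⟩ and -cⱼ.
    have hcα : ∀ j, c j = -α.covector x (b j) := by
      intro j
      have h3 := h₁.sub_eq_contract h₂ hs (X := fun i => sectionThrough E F (b i)) (b := b)
        (c := c) (fun i => by simp) (fun i => by rw [hc]; abel)
        (ofSec_mem_grade (sectionThrough E F (b j)))
      rw [hD', evalAt_ofSec, sectionThrough_apply] at h3
      have h4 : ∀ ξ : Module.Dual ℝ (A x), covectorContract ξ (ExteriorAlgebra.ι ℝ (b j)) =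
          algebraMap ℝ _ (ξ (b j)) := fun ξ => CliffordAlgebra.contractLeft_ι ..
      rw [h4, h4, ← map_neg] at h3
      have h5 := ExteriorAlgebra.algebraMap_leftInverse (R := ℝ) (A x) |>.injective h3
      rw [h5, neg_neg, LinearMap.sum_apply]
      simp [Finsupp.single_apply]
    have h0 : tensorialMap T hT = 0 := b.ext fun i => by
      rw [← sectionThrough_apply (E := E) (F := F) (b i), tensorialMap_apply]
      show evalAt x (C₁.nabla _ s).1 - evalAt x (C₂.nabla _ s).1 +
        α.covector x (sectionThrough E F (b i) x) • evalAt x s.1 = _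
      rw [← hc, hcα, sectionThrough_apply, neg_smul, neg_add_cancel]
      rfl
    have h6 := tensorialMap_apply T hT X
    rw [h0] at h6
    exact h6.symm
  refine homotopic_iff.2 ⟨α.smul (-1), hα.neg, fun X s x => ?_⟩
  have hall : evalAt x (C₁.nabla X s).1 - evalAt x (C₂.nabla X s).1 +
      α.covector x (X x) • evalAt x s.1 = 0 := by
    -- Where s vanishes, s + Λ and Λ are both nonzero at x, and the identity for s is the difference
    -- of theirs.
    by_cases hs : evalAt x s.1 = 0
    · obtain ⟨Λ, hΛ⟩ := exists_top_ne_zero (E := E) (F := F) (A := A) x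
      have h7 := key x X (s + Λ) (by
        rw [Submodule.coe_add, map_add, hs, zero_add]; exact hΛ)
      have h8 := key x X Λ hΛ
      simp only [map_add, Submodule.coe_add] at h7
      rw [← sub_eq_zero.2 (h7.trans h8.symm)]
      module
    · exact key x X s hs
  rw [Form.covector_smul_neg_one, LinearMap.neg_apply, ← sub_eq_zero, ← hall]
  module

end LieAlgebroid.TopConnection

end Algebroid

end AlgebroidHomology

end

/-! ### The theorem -/

theorem mainTheorem5
    {E : Type*} [NormedAddCommGroup E] [NormedSpace ℝ E] [FiniteDimensional ℝ E]
    {M : Type*} [TopologicalSpace M] [T2Space M] [SecondCountableTopology M]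
    [ChartedSpace E M] [IsManifold 𝓘(ℝ, E) ∞ M]
    {F : Type*} [NormedAddCommGroup F] [NormedSpace ℝ F] [FiniteDimensional ℝ F]
    {A : M → Type*} [TopologicalSpace (Bundle.TotalSpace F A)] [∀ x, TopologicalSpace (A x)]
    [∀ x, AddCommGroup (A x)] [∀ x, Module ℝ (A x)]
    [FiberBundle F A] [VectorBundle ℝ F A] [ContMDiffVectorBundle ∞ F A 𝓘(ℝ, E)]
    (L : AlgebroidHomology.LieAlgebroid E F A) :
    -- two generating operators differ by contraction with a section `α` of `A*`, and then
    -- `D'² - D² = -i_{dα}`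
    (∀ D' D : AlgebroidHomology.MultiField E F A →ₗ[ℝ] AlgebroidHomology.MultiField E F A,
      L.IsGenerating D' → L.IsGenerating D →
        (∃ α : AlgebroidHomology.Form E F A 1, ∀ U x,
          (D U).1 x - (D' U).1 x = AlgebroidHomology.contractAt F x (α.toFun x) (U.1 x)) ∧
        ∀ α : AlgebroidHomology.Form E F A 1,
          (∀ U x,
            (D U).1 x - (D' U).1 x = AlgebroidHomology.contractAt F x (α.toFun x) (U.1 x)) →
          (∀ U x, (D' (D' U)).1 x - (D (D U)).1 x =
            -AlgebroidHomology.contractAt F x (L.d α x) (U.1 x)) ∧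
          ((∀ U, D' (D' U) = 0) → (∀ U, D (D U) = 0) → L.IsClosedForm α)) ∧
    -- flat connections on `∧ⁿ A`: homotopy is the same for connections and for the corresponding
    -- operators, and homotopic connections have isomorphic homology
    (∀ C₁ C₂ : L.TopConnection, C₁.IsFlat → C₂.IsFlat →
      (∀ D₁ D₂ : AlgebroidHomology.MultiField E F A →ₗ[ℝ] AlgebroidHomology.MultiField E F A,
        C₁.IsOperator D₁ → C₂.IsOperator D₂ →
          (C₁.Homotopic C₂ ↔ L.HomotopicOperators D₁ D₂)) ∧
      (C₁.Homotopic C₂ → ∀ k, Nonempty (C₁.Homology k ≃ₗ[ℝ] C₂.Homology k))) := by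
  refine ⟨fun D' D hD' hD => ⟨?_, fun α hα => ?_⟩, fun C₁ C₂ _ _ => ⟨fun D₁ D₂ h₁ h₂ =>
    ⟨fun h => h.homotopicOperators h₁ h₂, fun h =>
      AlgebroidHomology.LieAlgebroid.TopConnection.homotopic_of_homotopicOperators h₁ h₂ h⟩,
    fun h k => h.nonempty_homology_equiv k⟩⟩
  · obtain ⟨α, hα⟩ := hD.exists_form_sub_eq_contract hD'
    refine ⟨α, fun U x => ?_⟩
    rw [AlgebroidHomology.contractAt_one]
    exact hα U x
  · have hα' : ∀ U x, AlgebroidHomology.evalAt x (D U) - AlgebroidHomology.evalAt x (D' U) =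
        AlgebroidHomology.covectorContract (α.covector x) (AlgebroidHomology.evalAt x U) :=
      fun U x => by
        rw [← AlgebroidHomology.contractAt_one]
        exact hα U x
    refine ⟨fun U x => hD.sq_sub_sq hα' U x, fun h' h =>
      L.isClosedForm_of_contract_eq_zero α fun U x => ?_⟩
    have := hD.sq_sub_sq hα' U x
    rwa [h', h, map_zero, sub_zero, eq_comm, neg_eq_zero] at this
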